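/- Let $g\ge 1$. A characteristic is a pair $m=\binom ab$ with $a,b\in\mathbb F_2^g$; it is even if $a^tb=0$ in $\mathbb F_2$. A Göpel group is a subspace $G\subset\mathbb F_2^{2g}$ that is maximal isotropic for the symplectic pairing $\langle\binom ab,\binom\alpha\beta\rangle=a^t\beta+b^t\alpha$; it has a unique translate $M=M_G$ consisting of even characteristics (its even coset). For $Z$ in the Siegel upper half space $\mathcal H_g$ put $$\vartheta[m](Z)=\sum_{n\in\mathbb Z^g}e^{\pi i\{Z[n+a/2]+b^t(n+a/2)\}},\qquad Z[v]=v^tZv,$$ where the entries of $a,b$ are represented by the integers $0,1$, and put $\vartheta_G=\prod_{m\in M_G}\vartheta[m]$. Let $k_g=4,2,1$ for $g=1$, $g=2$, $g\ge 3$, respectively, and let $\Gamma_g[2]$ be the kernel of the reduction $\mathrm{Sp}(g,\mathbb Z)\to\mathrm{Sp}(g,\mathbb Z/2\mathbb Z)$. Then: a) For each Göpel group $G$, the form $\vartheta_G^{k_g}$ is a Siegel modular form of weight $k_g2^{g-1}$ on $\Gamma_g[2]$ with trivial multiplier, i.e. it is holomorphic on $\mathcal H_g$, satisfies $f((AZ+B)(CZ+D)^{-1})=\det(CZ+D)^{k_g2^{g-1}}f(Z)$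 for all $\begin{pmatrix}A&B\\C&D\end{pmatrix}\in\Gamma_g[2]$ and, if $g=1$, is regular at all cusps. b) The forms $\vartheta_G^{k_g}$, where $G$ runs through all Göpel groups in $\mathbb F_2^{2g}$, are linearly independent over $\mathbb C$. -/

import Mathlib

open Matrix

namespace SiegelTheta

section HalfSpace

variable {g : ℕ}

/-- The Siegel modular group `Sp(g, ℤ)`. -/
abbrev ModularGroup (g : ℕ) : Type := symplecticGroup (Fin g) ℤ

/-- Reduction modulo `l`, as a homomorphism `Sp(g, ℤ) → Sp(g, ℤ/lℤ)`. -/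
def reduction (g l : ℕ) : ModularGroup g →* symplecticGroup (Fin g) (ZMod l) where
  toFun M := ⟨M.1.map (Int.castRingHom (ZMod l)),
    SymplecticGroup.map_mem M.2 (Int.castRingHom (ZMod l))⟩
  map_one' := by
    apply Subtype.ext
    simp
  map_mul' M N := by
    apply Subtype.ext
    exact Matrix.map_mul

/-- The principal congruence subgroup of level `l`. -/
def principalCongruenceSubgroup (g l : ℕ) : Subgroup (ModularGroup g) :=
  (reduction g l).ker

/-- The Siegel upper half space: symmetric complex `g × g` matrices with positive definite
imaginary part. -/
def siegelHalfSpace (g : ℕ) : Set (Matrix (Fin g) (Fin g) ℂ) :=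
  {Z | Zᵀ = Z ∧ (Z.map Complex.im).PosDef}

/-- A block of a modular matrix, with complex coefficients. -/
def blockA (M : ModularGroup g) : Matrix (Fin g) (Fin g) ℂ :=
  M.1.toBlocks₁₁.map (Int.cast : ℤ → ℂ)

/-- A block of a modular matrix, with complex coefficients. -/
def blockB (M : ModularGroup g) : Matrix (Fin g) (Fin g) ℂ :=
  M.1.toBlocks₁₂.map (Int.cast : ℤ → ℂ)

/-- A block of a modular matrix, with complex coefficients. -/
def blockC (M : ModularGroup g) : Matrix (Fin g) (Fin g) ℂ :=
  M.1.toBlocks₂₁.map (Int.cast : ℤ → ℂ)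

/-- A block of a modular matrix, with complex coefficients. -/
def blockD (M : ModularGroup g) : Matrix (Fin g) (Fin g) ℂ :=
  M.1.toBlocks₂₂.map (Int.cast : ℤ → ℂ)

/-- The numerator `A Z + B`. -/
def num (M : ModularGroup g) (Z : Matrix (Fin g) (Fin g) ℂ) : Matrix (Fin g) (Fin g) ℂ :=
  blockA M * Z + blockB M

/-- The denominator `C Z + D`. -/
def denom (M : ModularGroup g) (Z : Matrix (Fin g) (Fin g) ℂ) : Matrix (Fin g) (Fin g) ℂ :=
  blockC M * Z + blockD M

theorem block_relations (M : ModularGroup g) :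
    (blockA M)ᵀ * blockC M = (blockC M)ᵀ * blockA M ∧
    (blockB M)ᵀ * blockD M = (blockD M)ᵀ * blockB M ∧
    (blockA M)ᵀ * blockD M - (blockC M)ᵀ * blockB M = 1 ∧
    (blockD M)ᵀ * blockA M - (blockB M)ᵀ * blockC M = 1 := by
  have h := SymplecticGroup.mem_iff'.1
    (SymplecticGroup.map_mem M.2 (Int.castRingHom ℂ))
  have hM : M.1.map (Int.castRingHom ℂ)
      = fromBlocks (blockA M) (blockB M) (blockC M) (blockD M) := by
    ext i j
    rcases i with i | i <;> rcases j with j | j <;> rfl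
  rw [hM, J, fromBlocks_transpose, fromBlocks_multiply, fromBlocks_multiply,
    fromBlocks_inj] at h
  simp only [Matrix.mul_zero, Matrix.mul_one, Matrix.mul_neg, zero_add, add_zero,
    Matrix.neg_mul] at h
  obtain ⟨h1, h2, h3, h4⟩ := h
  refine ⟨?_, ?_, ?_, ?_⟩
  · rw [← sub_eq_zero, ← neg_eq_zero, ← h1]; abel
  · rw [← sub_eq_zero, ← neg_eq_zero, ← h4]; abel
  · rw [← neg_inj, ← h2]; abel
  · rw [← h3]; abel

theorem num_denom_identity (M : ModularGroup g) {Z W : Matrix (Fin g) (Fin g) ℂ}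
    (hZ : Zᵀ = Z) :
    (num M Z)ᵀ * denom M W - (denom M Z)ᵀ * num M W = Z - W := by
  obtain ⟨h1, h2, h3, h4⟩ := block_relations M
  have e : (num M Z)ᵀ * denom M W - (denom M Z)ᵀ * num M W
      = Z * ((blockA M)ᵀ * blockC M - (blockC M)ᵀ * blockA M) * W
        + Z * ((blockA M)ᵀ * blockD M - (blockC M)ᵀ * blockB M)
        - ((blockD M)ᵀ * blockA M - (blockB M)ᵀ * blockC M) * W
        + ((blockB M)ᵀ * blockD M - (blockD M)ᵀ * blockB M) := by
    simp only [num, denom, transpose_add, transpose_mul, hZ]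
    noncomm_ring
  rw [e, h3, h4, h1, h2]
  simp

theorem map_conj_num (M : ModularGroup g) (Z : Matrix (Fin g) (Fin g) ℂ) :
    (num M Z).map (starRingEnd ℂ) = num M (Z.map (starRingEnd ℂ)) := by
  have hA : (blockA M).map (starRingEnd ℂ) = blockA M := by ext i j; simp [blockA]
  have hB : (blockB M).map (starRingEnd ℂ) = blockB M := by ext i j; simp [blockB]
  rw [num, num, Matrix.map_add _ (map_add _), Matrix.map_mul, hA, hB]

theorem map_conj_denom (M : ModularGroup g) (Z : Matrix (Fin g) (Fin g) ℂ) :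
    (denom M Z).map (starRingEnd ℂ) = denom M (Z.map (starRingEnd ℂ)) := by
  have hA : (blockC M).map (starRingEnd ℂ) = blockC M := by ext i j; simp [blockC]
  have hB : (blockD M).map (starRingEnd ℂ) = blockD M := by ext i j; simp [blockD]
  rw [denom, denom, Matrix.map_add _ (map_add _), Matrix.map_mul, hA, hB]

/-- For symmetric `Z`, `v ᵗ (Z - conj Z) conj v = 2 i (Y[Re v] + Y[Im v])`. -/
theorem sub_conj_form {Z : Matrix (Fin g) (Fin g) ℂ} (hZ : Zᵀ = Z) (v : Fin g → ℂ) :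
    v ⬝ᵥ ((Z - Z.map (starRingEnd ℂ)) *ᵥ (star v)) =
      2 * Complex.I * (((fun i => (v i).re) ⬝ᵥ (Z.map Complex.im *ᵥ fun i => (v i).re) +
        (fun i => (v i).im) ⬝ᵥ (Z.map Complex.im *ᵥ fun i => (v i).im) : ℝ) : ℂ) := by
  have hs : ∀ i j, Z i j = Z j i := fun i j => by
    conv_lhs => rw [← hZ]
    rfl
  have key : ∀ a b : Fin g → ℝ, a ⬝ᵥ (Z.map Complex.im *ᵥ b) = b ⬝ᵥ (Z.map Complex.im *ᵥ a) := by
    intro a b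
    simp only [dotProduct, mulVec, Matrix.map_apply, Finset.mul_sum]
    rw [Finset.sum_comm]
    refine Finset.sum_congr rfl fun i _ => Finset.sum_congr rfl fun j _ => ?_
    rw [hs j i]; ring
  have e : v ⬝ᵥ ((Z - Z.map (starRingEnd ℂ)) *ᵥ (star v)) =
      2 * Complex.I * (((fun i => (v i).re) ⬝ᵥ (Z.map Complex.im *ᵥ fun i => (v i).re) +
        (fun i => (v i).im) ⬝ᵥ (Z.map Complex.im *ᵥ fun i => (v i).im) : ℝ) : ℂ)
      + 2 * (((fun i => (v i).re) ⬝ᵥ (Z.map Complex.im *ᵥ fun i => (v i).im) -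
        (fun i => (v i).im) ⬝ᵥ (Z.map Complex.im *ᵥ fun i => (v i).re) : ℝ) : ℂ) := by
    simp only [dotProduct, mulVec, Matrix.map_apply, Matrix.sub_apply, Finset.mul_sum,
      ← Finset.sum_add_distrib, ← Finset.sum_sub_distrib, Complex.ofReal_sum]
    refine Finset.sum_congr rfl fun i _ => Finset.sum_congr rfl fun j _ => ?_
    apply Complex.ext <;> simp <;> ring
  rw [e, key (fun i => (v i).re) (fun i => (v i).im)]
  simp

theorem sub_conj_form_pos {Z : Matrix (Fin g) (Fin g) ℂ} (hZ : Z ∈ siegelHalfSpace g)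
    {v : Fin g → ℂ} (hv : v ≠ 0) :
    0 < (fun i => (v i).re) ⬝ᵥ (Z.map Complex.im *ᵥ fun i => (v i).re) +
        (fun i => (v i).im) ⬝ᵥ (Z.map Complex.im *ᵥ fun i => (v i).im) := by
  have hn : ∀ a : Fin g → ℝ, 0 ≤ a ⬝ᵥ (Z.map Complex.im *ᵥ a) := fun a => by
    simpa using hZ.2.posSemidef.dotProduct_mulVec_nonneg a
  have hp : ∀ a : Fin g → ℝ, a ≠ 0 → 0 < a ⬝ᵥ (Z.map Complex.im *ᵥ a) := fun a ha => by
    simpa using hZ.2.dotProduct_mulVec_pos ha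
  by_cases h : (fun i => (v i).re) = 0
  · have h' : (fun i => (v i).im) ≠ 0 := by
      intro h'
      apply hv
      funext i
      exact Complex.ext (congrFun h i) (congrFun h' i)
    exact add_pos_of_nonneg_of_pos (hn _) (hp _ h')
  · exact add_pos_of_pos_of_nonneg (hp _ h) (hn _)

theorem isUnit_det_denom (M : ModularGroup g) {Z : Matrix (Fin g) (Fin g) ℂ}
    (hZ : Z ∈ siegelHalfSpace g) : IsUnit (denom M Z).det := by
  rw [isUnit_iff_ne_zero]
  intro h0
  obtain ⟨v, hv, hv0⟩ := Matrix.exists_mulVec_eq_zero_iff.2 h0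
  have hid := num_denom_identity M (W := Z.map (starRingEnd ℂ)) hZ.1
  have hc : denom M (Z.map (starRingEnd ℂ)) *ᵥ star v = 0 := by
    rw [← map_conj_denom]
    have := congrArg star hv0
    rw [star_mulVec] at this
    rw [star_zero, ← Matrix.mulVec_transpose] at this
    exact this
  have h1 : v ⬝ᵥ ((Z - Z.map (starRingEnd ℂ)) *ᵥ (star v)) = 0 := by
    rw [← hid, Matrix.sub_mulVec, ← Matrix.mulVec_mulVec, ← Matrix.mulVec_mulVec, hc,
      Matrix.mulVec_zero, zero_sub, dotProduct_neg, Matrix.dotProduct_mulVec,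
      Matrix.vecMul_transpose, hv0, zero_dotProduct, neg_zero]
  rw [sub_conj_form hZ.1] at h1
  have h2 := sub_conj_form_pos hZ hv
  simp only [mul_eq_zero, OfNat.ofNat_ne_zero, Complex.I_ne_zero, or_self, false_or,
    Complex.ofReal_eq_zero] at h1
  exact h2.ne' h1

theorem moebius_aux {P Q Z : Matrix (Fin g) (Fin g) ℂ} (hu : IsUnit Q.det)
    (hid0 : Pᵀ * Q = Qᵀ * P)
    (hid : Pᵀ * Q.map (starRingEnd ℂ) - Qᵀ * P.map (starRingEnd ℂ) = Z - Z.map (starRingEnd ℂ))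
    (hZ : Z ∈ siegelHalfSpace g) : P * Q⁻¹ ∈ siegelHalfSpace g := by
  have hut : IsUnit Qᵀ.det := by rwa [det_transpose]
  obtain ⟨W, hW⟩ : ∃ W, W = P * Q⁻¹ := ⟨_, rfl⟩
  have hWQ : W * Q = P := by
    rw [hW, Matrix.mul_assoc, nonsing_inv_mul _ hu, Matrix.mul_one]
  have hsym : Wᵀ = W := by
    rw [hW, transpose_mul, transpose_nonsing_inv]
    calc Qᵀ⁻¹ * Pᵀ = Qᵀ⁻¹ * (Pᵀ * (Q * Q⁻¹)) := by rw [mul_nonsing_inv _ hu, Matrix.mul_one]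
      _ = Qᵀ⁻¹ * (Pᵀ * Q) * Q⁻¹ := by simp only [Matrix.mul_assoc]
      _ = (Qᵀ⁻¹ * Qᵀ) * P * Q⁻¹ := by rw [hid0]; simp only [Matrix.mul_assoc]
      _ = P * Q⁻¹ := by rw [nonsing_inv_mul _ hut, Matrix.one_mul]
  rw [← hW]
  have hrel : Qᵀ * (W - W.map (starRingEnd ℂ)) * Q.map (starRingEnd ℂ)
      = Z - Z.map (starRingEnd ℂ) := by
    rw [← hid, Matrix.mul_sub, Matrix.sub_mul]
    congr 1
    · rw [← hWQ, transpose_mul, hsym]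
    · rw [Matrix.mul_assoc, ← Matrix.map_mul, hWQ]
  refine ⟨hsym, Matrix.PosDef.of_dotProduct_mulVec_pos ?_ ?_⟩
  · ext i j
    have := congrFun (congrFun hsym i) j
    rw [transpose_apply] at this
    simp [this]
  · intro x hx
    obtain ⟨v, hQv⟩ : ∃ v, Q *ᵥ v = fun i => (x i : ℂ) :=
      ⟨Q⁻¹ *ᵥ fun i => (x i : ℂ), by
        rw [Matrix.mulVec_mulVec, mul_nonsing_inv _ hu, Matrix.one_mulVec]⟩
    have hv : v ≠ 0 := by
      intro h
      rw [h, Matrix.mulVec_zero] at hQv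
      apply hx
      funext i
      simpa using (congrFun hQv i).symm
    have hQc : Q.map (starRingEnd ℂ) *ᵥ star v = star (fun i => (x i : ℂ)) := by
      have := congrArg star hQv
      rw [star_mulVec, ← Matrix.mulVec_transpose] at this
      exact this
    have h1 : v ⬝ᵥ ((Z - Z.map (starRingEnd ℂ)) *ᵥ star v)
        = (fun i => (x i : ℂ)) ⬝ᵥ ((W - W.map (starRingEnd ℂ)) *ᵥ star (fun i => (x i : ℂ))) := by
      rw [← hrel, ← Matrix.mulVec_mulVec, ← Matrix.mulVec_mulVec, Matrix.dotProduct_mulVec,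
        Matrix.vecMul_transpose, hQv, hQc]
    rw [sub_conj_form hZ.1, sub_conj_form hsym] at h1
    have h2 := sub_conj_form_pos hZ hv
    have h3 := mul_left_cancel₀ (by simp : (2 * Complex.I : ℂ) ≠ 0) h1
    rw [Complex.ofReal_inj] at h3
    rw [h3] at h2
    simpa [dotProduct, mulVec] using h2

theorem moebius_mem (M : ModularGroup g) {Z : Matrix (Fin g) (Fin g) ℂ}
    (hZ : Z ∈ siegelHalfSpace g) : num M Z * (denom M Z)⁻¹ ∈ siegelHalfSpace g := by
  have hid0 := num_denom_identity M (W := Z) hZ.1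
  have hid := num_denom_identity M (W := Z.map (starRingEnd ℂ)) hZ.1
  rw [sub_self, sub_eq_zero] at hid0
  rw [← map_conj_denom, ← map_conj_num] at hid
  exact moebius_aux (isUnit_det_denom M hZ) hid0 hid hZ

/-- The action `Z ↦ (A Z + B) (C Z + D)⁻¹` of the Siegel modular group on the half space. -/
noncomputable def moebius (M : ModularGroup g) (Z : siegelHalfSpace g) : siegelHalfSpace g :=
  ⟨num M Z.1 * (denom M Z.1)⁻¹, moebius_mem M Z.2⟩

/-- The factor `det (C Z + D)`. -/
noncomputable def autFactor (M : ModularGroup g) (Z : siegelHalfSpace g) : ℂ :=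
  (denom M Z.1).det

/-- The symmetric matrix with coordinates `w`: its `(i, j)` and `(j, i)` entries are
`w s(i, j)`.  This is a linear isomorphism from `ℂ ^ (g (g + 1) / 2)` onto the space of symmetric
matrices. -/
def symmetricOfCoords (w : Sym2 (Fin g) → ℂ) : Matrix (Fin g) (Fin g) ℂ :=
  Matrix.of fun i j => w s(i, j)

open Classical in
/-- A function on the half space is holomorphic if it is complex differentiable as a function of
the `g (g + 1) / 2` independent entries of `Z`, on the open set of coordinate vectors of points of
the half space.  (The value `0` outside this open set plays no role.) -/
def IsHolomorphic (f : siegelHalfSpace g → ℂ) : Prop :=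
  DifferentiableOn ℂ
    (fun w : Sym2 (Fin g) → ℂ =>
      if h : symmetricOfCoords w ∈ siegelHalfSpace g then f ⟨symmetricOfCoords w, h⟩ else 0)
    {w | symmetricOfCoords w ∈ siegelHalfSpace g}

/-- `f` is regular at all cusps for the weight `k`: for every `N ∈ Sp(g, ℤ)` the transformed
function `det (C Z + D) ^ (-k) * f (N Z)` is bounded on some domain `Im Z ≥ R`. -/
def IsRegularAtCusps (k : ℤ) (f : siegelHalfSpace g → ℂ) : Prop :=
  ∀ N : ModularGroup g, ∃ R K : ℝ, ∀ Z : siegelHalfSpace g,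
    (Z.1.map Complex.im - R • (1 : Matrix (Fin g) (Fin g) ℝ)).PosSemidef →
      ‖autFactor N Z ^ (-k) * f (moebius N Z)‖ ≤ K

/-- `f ∈ [Γ, k]`: Siegel modular forms of integral weight `k` with trivial multipliers on a
subgroup `Γ` of the Siegel modular group.  In degree one, regularity at the cusps is required. -/
structure IsSiegelModularForm (Γ : Subgroup (ModularGroup g)) (k : ℤ)
    (f : siegelHalfSpace g → ℂ) : Prop where
  holomorphic : IsHolomorphic f
  transform : ∀ M ∈ Γ, ∀ Z : siegelHalfSpace g, f (moebius M Z) = autFactor M Z ^ k * f Z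
  regular : g = 1 → IsRegularAtCusps k f

end HalfSpace

section Characteristics

variable {g : ℕ}

/-- Theta characteristics: pairs `m = (a, b)` of vectors over the field with two elements. -/
abbrev Characteristic (g : ℕ) : Type := (Fin g → ZMod 2) × (Fin g → ZMod 2)

/-- A characteristic `(a, b)` is even if `aᵗ b = 0`. -/
def IsEven (m : Characteristic g) : Prop := m.1 ⬝ᵥ m.2 = 0

/-- The symplectic pairing `⟨(a, b), (α, β)⟩ = aᵗ β + bᵗ α`. -/
def pairing (m n : Characteristic g) : ZMod 2 := m.1 ⬝ᵥ n.2 + m.2 ⬝ᵥ n.1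

/-- A subspace is isotropic if the symplectic pairing vanishes on it. -/
def IsIsotropic (G : Submodule (ZMod 2) (Characteristic g)) : Prop :=
  ∀ m ∈ G, ∀ n ∈ G, pairing m n = 0

/-- Göpel groups: the maximal isotropic subspaces. -/
def GopelGroup (g : ℕ) : Type :=
  {G : Submodule (ZMod 2) (Characteristic g) // Maximal IsIsotropic G}

/-- `M` is a translate of `G` that consists of even characteristics. -/
def IsEvenTranslate (G : Submodule (ZMod 2) (Characteristic g)) (M : Set (Characteristic g)) :
    Prop :=
  (∃ c, M = {m | ∃ x ∈ G, m = c + x}) ∧ ∀ m ∈ M, IsEven m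

theorem zmod_add_self (t : ZMod 2) : t + t = 0 := by
  revert t; decide

theorem dot_parity (m n : Characteristic g) :
    (m + n).1 ⬝ᵥ (m + n).2 = m.1 ⬝ᵥ m.2 + n.1 ⬝ᵥ n.2 + pairing m n := by
  simp only [pairing, Prod.fst_add, Prod.snd_add, add_dotProduct, dotProduct_add,
    dotProduct_comm m.2 n.1]
  ring

theorem pairing_comm (m n : Characteristic g) : pairing m n = pairing n m := by
  simp only [pairing, dotProduct_comm n.1, dotProduct_comm n.2]
  ring

theorem pairing_add_left (m m' n : Characteristic g) :
    pairing (m + m') n = pairing m n + pairing m' n := by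
  simp only [pairing, Prod.fst_add, Prod.snd_add, add_dotProduct]
  ring

theorem pairing_add_right (m n n' : Characteristic g) :
    pairing m (n + n') = pairing m n + pairing m n' := by
  rw [pairing_comm, pairing_add_left, pairing_comm n, pairing_comm n']

theorem pairing_smul_left (c : ZMod 2) (m n : Characteristic g) :
    pairing (c • m) n = c * pairing m n := by
  simp only [pairing, Prod.smul_fst, Prod.smul_snd, smul_dotProduct, smul_eq_mul]
  ring

theorem pairing_smul_right (c : ZMod 2) (m n : Characteristic g) :
    pairing m (c • n) = c * pairing m n := by
  rw [pairing_comm, pairing_smul_left, pairing_comm]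

theorem pairing_self (m : Characteristic g) : pairing m m = 0 := by
  rw [pairing, dotProduct_comm m.2, zmod_add_self]

/-- A maximal isotropic subspace contains its orthogonal complement. -/
theorem mem_of_pairing_eq_zero {G : Submodule (ZMod 2) (Characteristic g)}
    (hG : Maximal IsIsotropic G) {x : Characteristic g} (hx : ∀ n ∈ G, pairing x n = 0) :
    x ∈ G := by
  have h : IsIsotropic (G ⊔ Submodule.span (ZMod 2) {x}) := by
    intro m hm n hn
    obtain ⟨m₁, hm₁, m₂, hm₂, rfl⟩ := Submodule.mem_sup.1 hm
    obtain ⟨n₁, hn₁, n₂, hn₂, rfl⟩ := Submodule.mem_sup.1 hn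
    obtain ⟨c, rfl⟩ := Submodule.mem_span_singleton.1 hm₂
    obtain ⟨d, rfl⟩ := Submodule.mem_span_singleton.1 hn₂
    simp only [pairing_add_left, pairing_add_right, pairing_smul_left, pairing_smul_right,
      hG.1 _ hm₁ _ hn₁, hx _ hn₁, pairing_comm m₁ x, hx _ hm₁, pairing_self]
    ring
  exact hG.2 h le_sup_left (Submodule.mem_sup_right (Submodule.mem_span_singleton_self x))

/-- Every linear form is a pairing with a characteristic. -/
theorem exists_pairing_eq (φ : Characteristic g →ₗ[ZMod 2] ZMod 2) :
    ∃ x, ∀ n, pairing x n = φ n := by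
  refine ⟨(fun i => φ (0, Pi.single i 1), fun i => φ (Pi.single i 1, 0)), fun n => ?_⟩
  have h1 : φ n = φ (LinearMap.inl (ZMod 2) _ _ n.1) + φ (LinearMap.inr (ZMod 2) _ _ n.2) := by
    rw [← map_add]; simp
  have h2 := LinearMap.pi_apply_eq_sum_univ (φ ∘ₗ LinearMap.inl (ZMod 2) _ (Fin g → ZMod 2)) n.1
  have h3 := LinearMap.pi_apply_eq_sum_univ (φ ∘ₗ LinearMap.inr (ZMod 2) (Fin g → ZMod 2) _) n.2
  simp only [LinearMap.comp_apply] at h2 h3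
  rw [h1, h2, h3, add_comm]
  simp only [pairing, dotProduct, smul_eq_mul, LinearMap.inl_apply, LinearMap.inr_apply]
  have e : ∀ i : Fin g, (Pi.single i 1 : Fin g → ZMod 2) = fun j => if i = j then 1 else 0 := by
    intro i; ext j; simp [Pi.single_apply, eq_comm]
  simp only [e, mul_comm]

/-- The sign `(-1) ^ t`. -/
def sign (t : ZMod 2) : ℤ := if t = 0 then 1 else -1

theorem sign_add (s t : ZMod 2) : sign (s + t) = sign s * sign t := by
  revert s t; decide

open Classical in
/-- A quadratic form with the pairing as polar form that vanishes on a subspace `G` equal to its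
own orthogonal complement has more zeros than non-zeros. -/
theorem sum_sign_pos (q : Characteristic g → ZMod 2)
    (hq : ∀ m n, q (m + n) = q m + q n + pairing m n)
    (G : Submodule (ZMod 2) (Characteristic g)) (h0 : ∀ m ∈ G, q m = 0)
    (hG : ∀ x, (∀ n ∈ G, pairing x n = 0) → x ∈ G) : 0 < ∑ y, sign (q y) := by
  have hcard : (0 : ℤ) < ∑ _h : G, 1 := by
    simp only [Finset.sum_const, Finset.card_univ, nsmul_eq_mul, mul_one]
    exact_mod_cast Fintype.card_pos
  have hinner : ∀ y, sign (q y) * ∑ h : G, sign (pairing y h) = if y ∈ G then ∑ _h : G, 1 else 0 := by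
    intro y
    split_ifs with hy
    · rw [h0 y hy, Finset.mul_sum]
      refine Finset.sum_congr rfl fun h _ => ?_
      have e := hq y h
      rw [h0 _ hy, h0 _ h.2, h0 _ (G.add_mem hy h.2), zero_add, zero_add] at e
      rw [← e]; rfl
    · have : ∃ n ∈ G, pairing y n ≠ 0 := by
        by_contra hc
        push Not at hc
        exact hy (hG y hc)
      obtain ⟨n, hn, hne⟩ := this
      have hs : ∑ h : G, sign (pairing y h) = - ∑ h : G, sign (pairing y h) := by
        conv_lhs => rw [← Equiv.sum_comp (Equiv.addRight (⟨n, hn⟩ : G))]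
        rw [← Finset.sum_neg_distrib]
        refine Finset.sum_congr rfl fun h _ => ?_
        simp only [Equiv.coe_addRight, Submodule.coe_add, pairing_add_right, sign_add]
        simp [sign, hne]
      have : ∑ h : G, sign (pairing y h) = 0 := by linarith
      rw [this, mul_zero]
  have hmain : (∑ _h : G, (1 : ℤ)) * ∑ y, sign (q y) = ∑ y : Characteristic g,
      if y ∈ G then ∑ _h : G, (1 : ℤ) else 0 := by
    simp only [← hinner]
    simp only [Finset.mul_sum, Finset.sum_mul, one_mul]
    conv_lhs => rw [Finset.sum_comm]
    conv_rhs => rw [Finset.sum_comm]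
    refine Finset.sum_congr rfl fun h _ => ?_
    rw [← Equiv.sum_comp (Equiv.addRight (h : Characteristic g))]
    refine Finset.sum_congr rfl fun y _ => ?_
    rw [Equiv.coe_addRight, hq, h0 _ h.2, add_zero, sign_add]
  have hpos : 0 < ∑ y : Characteristic g, if y ∈ G then ∑ _h : G, (1 : ℤ) else 0 := by
    refine Finset.sum_pos' (fun y _ => ?_) ⟨0, Finset.mem_univ _, ?_⟩
    · split_ifs
      · exact hcard.le
      · exact le_rfl
    · simpa using hcard
  rw [← hmain] at hpos
  exact pos_of_mul_pos_right hpos hcard.le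

/-- Each Göpel group has a unique translate that consists of even characteristics. -/
theorem existsUnique_evenTranslate {G : Submodule (ZMod 2) (Characteristic g)}
    (hG : Maximal IsIsotropic G) : ∃! M, IsEvenTranslate G M := by
  have hex : ∃ x : Characteristic g, ∀ n ∈ G, pairing x n = n.1 ⬝ᵥ n.2 := by
    let ψ : G →ₗ[ZMod 2] ZMod 2 :=
      { toFun := fun n => n.1.1 ⬝ᵥ n.1.2
        map_add' := fun m n => by
          have := dot_parity m.1 n.1
          rw [hG.1 _ m.2 _ n.2, add_zero] at this
          exact this
        map_smul' := fun c n => by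
          have hc : c * c = c := by revert c; decide
          simp only [Submodule.coe_smul, Prod.smul_fst, Prod.smul_snd, smul_dotProduct,
            dotProduct_smul, smul_eq_mul, RingHom.id_apply]
          rw [← mul_assoc, hc] }
    obtain ⟨φ, hφ⟩ := LinearMap.exists_extend ψ
    obtain ⟨x, hx⟩ := exists_pairing_eq φ
    refine ⟨x, fun n hn => ?_⟩
    rw [hx]
    exact congrArg (fun f : G →ₗ[ZMod 2] ZMod 2 => f ⟨n, hn⟩) hφ
  obtain ⟨x, hx⟩ := hex
  have hx0 : x.1 ⬝ᵥ x.2 = 0 := by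
    have s1 := sum_sign_pos (g := g) (fun y => y.1 ⬝ᵥ y.2) dot_parity
      (LinearMap.ker (LinearMap.snd (ZMod 2) (Fin g → ZMod 2) (Fin g → ZMod 2)))
      (fun m hm => by
        have hm' : m.2 = 0 := hm
        simp [hm'])
      (fun y hy => by
        change y.2 = 0
        funext i
        have := hy (Pi.single i 1, 0) (by simp)
        simpa [pairing] using this)
    have s2 := sum_sign_pos (g := g) (fun y => y.1 ⬝ᵥ y.2 + pairing x y)
      (fun m n => by
        simp only [dot_parity, pairing_add_right]
        ring)
      G (fun m hm => by
        rw [hx m hm, zmod_add_self])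
      (fun y hy => mem_of_pairing_eq_zero hG hy)
    have s3 : ∑ y : Characteristic g, sign (y.1 ⬝ᵥ y.2)
        = sign (x.1 ⬝ᵥ x.2) * ∑ y : Characteristic g, sign (y.1 ⬝ᵥ y.2 + pairing x y) := by
      rw [← Equiv.sum_comp (Equiv.addLeft x), Finset.mul_sum]
      refine Finset.sum_congr rfl fun y _ => ?_
      rw [Equiv.coe_addLeft, dot_parity, add_assoc, sign_add]
    by_contra hne
    rw [s3] at s1
    simp only [sign, hne, if_false] at s1 s2
    linarith
  refine ⟨{m | ∃ y ∈ G, m = x + y}, ⟨⟨x, rfl⟩, ?_⟩, ?_⟩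
  · rintro m ⟨y, hy, rfl⟩
    rw [IsEven, dot_parity, hx0, hx y hy, zero_add, zmod_add_self]
  · rintro M ⟨⟨c, rfl⟩, hM⟩
    have hc : c.1 ⬝ᵥ c.2 = 0 := hM c ⟨0, G.zero_mem, by simp⟩
    have hcy : ∀ n ∈ G, pairing c n = n.1 ⬝ᵥ n.2 := by
      intro n hn
      have h : (c + n).1 ⬝ᵥ (c + n).2 = 0 := hM (c + n) ⟨n, hn, rfl⟩
      rw [dot_parity, hc, zero_add] at h
      have h' := zmod_add_self (n.1 ⬝ᵥ n.2)
      exact add_left_cancel (h.trans h'.symm)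
    have hmem : c + x ∈ G := mem_of_pairing_eq_zero hG fun n hn => by
      rw [pairing_add_left, hcy n hn, hx n hn, zmod_add_self]
    have hcc : ∀ z : Characteristic g, z + z = 0 := fun z => by
      ext i <;> exact zmod_add_self _
    ext m
    constructor
    · rintro ⟨y, hy, rfl⟩
      refine ⟨c + x + y, G.add_mem hmem hy, ?_⟩
      rw [show x + (c + x + y) = c + y + (x + x) by abel, hcc, add_zero]
    · rintro ⟨y, hy, rfl⟩
      refine ⟨c + x + y, G.add_mem hmem hy, ?_⟩
      rw [show c + (c + x + y) = x + y + (c + c) by abel, hcc, add_zero]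

/-- The even coset of a Göpel group: its unique translate consisting of even characteristics. -/
noncomputable def evenCoset (G : GopelGroup g) : Set (Characteristic g) :=
  (existsUnique_evenTranslate G.2).choose

end Characteristics

section Theta

variable {g : ℕ}

/-- The integer `0` or `1` that represents an element of the field with two elements. -/
def lift (t : ZMod 2) : ℤ := (t.val : ℤ)

/-- The theta constant
`θ[a, b](Z) = ∑_{n ∈ ℤ ^ g} exp (π i (Z[n + a / 2] + bᵗ (n + a / 2)))`, where `Z[v] = vᵗ Z v`. -/
noncomputable def thetaConstant (m : Characteristic g) (Z : siegelHalfSpace g) : ℂ :=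
  ∑' n : Fin g → ℤ,
    let v : Fin g → ℂ := fun i => (n i : ℂ) + (lift (m.1 i) : ℂ) / 2
    let b : Fin g → ℂ := fun i => (lift (m.2 i) : ℂ)
    Complex.exp (Real.pi * Complex.I * (v ⬝ᵥ (Z.1 *ᵥ v) + b ⬝ᵥ v))

open Classical in
/-- The product of the theta constants over the even coset of a Göpel group. -/
noncomputable def thetaGopel (G : GopelGroup g) (Z : siegelHalfSpace g) : ℂ :=
  ∏ m : Characteristic g with m ∈ evenCoset G, thetaConstant m Z

/-- The exponents `k_g = 4, 2, 1` for `g = 1`, `g = 2`, `g ≥ 3`. -/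
def gopelExponent (g : ℕ) : ℕ :=
  if g = 1 then 4 else if g = 2 then 2 else 1

end Theta

end SiegelTheta

namespace SiegelTheta

/-! ### Cocycle relation and group action on the half space. -/

section Action

variable {g : ℕ}

/-! Translations `Z ↦ Z + S` and inversions in one coordinate send each theta constant to another
one, up to a nonzero constant and a function whose square is proportional to `det (C Z + D)`. The
induced map on characteristics is affine, symplectic in its linear part, and preserves evenness, so
it carries even cosets to even cosets. A coset has `2 ^ g` elements, hence these matrices permute
the forms `θ_G ^ k_g` up to constants, with the right weight (`permutesGopelForms_of_theta`).

Trivial multiplier: the matrices fixing every form in weight `k_g 2 ^ (g - 1)` form a subgroup,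
stable under conjugation by translations and inversions. The level two group is generated by squares
of transvections along basis vectors and sums of two of them
(`HasSquares.eq_principalCongruenceSubgroup`, an even Euclidean algorithm), and these squares are
conjugate to translations by `2 p pᵗ`. Such a translation multiplies `θ[a, b]` by `i` if `pᵗ a` is
odd and by `1` otherwise. On an even coset the first case occurs `0`, `2 ^ (g - 1)` or `2 ^ g`
times, and `4 ∣ k_g 2 ^ (g - 1)`, so the powers of `i` cancel (`four_dvd_card_filter`). Holomorphy
comes from locally uniform Gaussian majorants. In degree one, six words represent the group modulo
two, so every modular matrix permutes the forms up to constants, and regularity reduces to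
boundedness for `Im Z ≥ 1`.

Independence: along `Z = (N + 1) i` the constant `θ[a, b]` tends to `1` if `a = 0` and to `0`
otherwise. In the limit of a linear relation only the Göpel group `a = 0` survives, so its
coefficient is zero. Every other Göpel group is moved to this one by inversions and a translation,
which carry relations to relations (`CoefficientVanishes.of_permutes`, `coefficientVanishes`). -/

theorem fromBlocks_block (M : ModularGroup g) :
    M.1.map (Int.castRingHom ℂ) = fromBlocks (blockA M) (blockB M) (blockC M) (blockD M) := by
  ext i j
  rcases i with i | i <;> rcases j with j | j <;> rfl

theorem block_mul (M N : ModularGroup g) :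
    blockA (M * N) = blockA M * blockA N + blockB M * blockC N ∧
    blockB (M * N) = blockA M * blockB N + blockB M * blockD N ∧
    blockC (M * N) = blockC M * blockA N + blockD M * blockC N ∧
    blockD (M * N) = blockC M * blockB N + blockD M * blockD N := by
  have h := fromBlocks_block (M * N)
  have e : (M * N).1.map (Int.castRingHom ℂ)
      = M.1.map (Int.castRingHom ℂ) * N.1.map (Int.castRingHom ℂ) := Matrix.map_mul
  rw [e, fromBlocks_block, fromBlocks_block, fromBlocks_multiply, fromBlocks_inj] at h
  exact ⟨h.1.symm, h.2.1.symm, h.2.2.1.symm, h.2.2.2.symm⟩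

theorem moebius_mul_denom (M : ModularGroup g) (Z : siegelHalfSpace g) :
    (moebius M Z).1 * denom M Z.1 = num M Z.1 := by
  rw [moebius, Matrix.mul_assoc, nonsing_inv_mul _ (isUnit_det_denom M Z.2), Matrix.mul_one]

/-- Characterizing the image point without an inverse turns the action and the explicit formulas
below into matrix identities. -/
theorem moebius_eq_of_mul_denom (M : ModularGroup g) (Z : siegelHalfSpace g)
    {W : Matrix (Fin g) (Fin g) ℂ} (h : W * denom M Z.1 = num M Z.1) : (moebius M Z).1 = W := by
  change num M Z.1 * (denom M Z.1)⁻¹ = W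
  rw [← h, Matrix.mul_assoc, mul_nonsing_inv _ (isUnit_det_denom M Z.2), Matrix.mul_one]

theorem denom_mul (M N : ModularGroup g) (Z : siegelHalfSpace g) :
    denom (M * N) Z.1 = denom M (moebius N Z).1 * denom N Z.1 := by
  obtain ⟨-, -, h3, h4⟩ := block_mul M N
  rw [denom, denom, Matrix.add_mul, Matrix.mul_assoc, moebius_mul_denom, h3, h4, num, denom]
  noncomm_ring

theorem num_mul (M N : ModularGroup g) (Z : siegelHalfSpace g) :
    num (M * N) Z.1 = num M (moebius N Z).1 * denom N Z.1 := by
  obtain ⟨h1, h2, -, -⟩ := block_mul M N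
  rw [num, num, Matrix.add_mul, Matrix.mul_assoc, moebius_mul_denom, h1, h2, num, denom]
  noncomm_ring

theorem autFactor_mul (M N : ModularGroup g) (Z : siegelHalfSpace g) :
    autFactor (M * N) Z = autFactor M (moebius N Z) * autFactor N Z := by
  rw [autFactor, denom_mul, det_mul]; rfl

theorem moebius_mul (M N : ModularGroup g) (Z : siegelHalfSpace g) :
    moebius (M * N) Z = moebius M (moebius N Z) := by
  apply Subtype.ext
  apply moebius_eq_of_mul_denom
  rw [denom_mul, num_mul, ← Matrix.mul_assoc, moebius_mul_denom]

theorem autFactor_ne_zero (M : ModularGroup g) (Z : siegelHalfSpace g) : autFactor M Z ≠ 0 :=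
  (isUnit_det_denom M Z.2).ne_zero

theorem denom_one (Z : Matrix (Fin g) (Fin g) ℂ) : denom 1 Z = 1 := by
  have h := fromBlocks_block (1 : ModularGroup g)
  have e : (1 : ModularGroup g).1.map (Int.castRingHom ℂ) = 1 := by simp
  rw [e, ← fromBlocks_one, fromBlocks_inj] at h
  rw [denom, ← h.2.2.1, ← h.2.2.2]; simp

theorem num_one (Z : Matrix (Fin g) (Fin g) ℂ) : num 1 Z = Z := by
  have h := fromBlocks_block (1 : ModularGroup g)
  have e : (1 : ModularGroup g).1.map (Int.castRingHom ℂ) = 1 := by simp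
  rw [e, ← fromBlocks_one, fromBlocks_inj] at h
  rw [num, ← h.1, ← h.2.1]; simp

theorem autFactor_one (Z : siegelHalfSpace g) : autFactor 1 Z = 1 := by
  rw [autFactor, denom_one, det_one]

theorem moebius_one (Z : siegelHalfSpace g) : moebius 1 Z = Z := by
  apply Subtype.ext
  apply moebius_eq_of_mul_denom
  rw [denom_one, num_one, Matrix.mul_one]

end Action

/-! ### Translations and coordinate inversions. -/

section Elements

variable {g : ℕ}

/-- The translation `Z ↦ Z + S` by an integral symmetric matrix. -/
def translation (S : Matrix (Fin g) (Fin g) ℤ) (hS : Sᵀ = S) : ModularGroup g :=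
  ⟨fromBlocks 1 S 0 1, by
    rw [SymplecticGroup.fromBlocks_mem_iff]
    simp [hS]⟩

theorem autFactor_translation (S : Matrix (Fin g) (Fin g) ℤ) (hS : Sᵀ = S)
    (Z : siegelHalfSpace g) : autFactor (translation S hS) Z = 1 := by
  have h : denom (translation S hS) Z.1 = 1 := by
    simp [denom, blockC, blockD, translation]
  rw [autFactor, h, det_one]

theorem moebius_translation (S : Matrix (Fin g) (Fin g) ℤ) (hS : Sᵀ = S)
    (Z : siegelHalfSpace g) :
    (moebius (translation S hS) Z).1 = Z.1 + S.map (Int.cast : ℤ → ℂ) := by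
  apply moebius_eq_of_mul_denom
  simp [denom, num, blockA, blockB, blockC, blockD, translation]

/-- The inversion in the `i`-th coordinate; see `inverted` for its action on the half space. -/
def inversion (i : Fin g) : ModularGroup g :=
  ⟨fromBlocks (1 - Matrix.single i i 1) (Matrix.single i i 1) (-Matrix.single i i 1)
      (1 - Matrix.single i i 1), by
    rw [SymplecticGroup.fromBlocks_mem_iff]
    simp [Matrix.sub_mul, Matrix.mul_sub]⟩

theorem denom_inversion (i : Fin g) (Z : Matrix (Fin g) (Fin g) ℂ) (k l : Fin g) :
    denom (inversion i) Z k l = if k = i then -Z i l else (1 : Matrix (Fin g) (Fin g) ℂ) k l := by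
  have e : (Matrix.single i i (1 : ℤ)).map (Int.cast : ℤ → ℂ) = Matrix.single i i 1 := by
    ext a b; simp [Matrix.single_apply]
  have e1 : (1 : Matrix (Fin g) (Fin g) ℤ).map (Int.cast : ℤ → ℂ) = 1 := by
    simp
  have e2 : denom (inversion i) Z = -(Matrix.single i i 1 * Z) + (1 - Matrix.single i i 1) := by
    simp only [denom, blockC, blockD, inversion, toBlocks_fromBlocks₂₁, toBlocks_fromBlocks₂₂]
    rw [Matrix.map_sub _ (by simp), e1, ← e, ← Matrix.neg_mul]
    congr 2
    ext a b; simp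
  rw [e2]
  by_cases h : k = i
  · subst h
    simp [Matrix.single_apply, Matrix.one_apply]
  · simp [h, Ne.symm h, Matrix.single_mul_apply_of_ne]

theorem num_inversion (i : Fin g) (Z : Matrix (Fin g) (Fin g) ℂ) (k l : Fin g) :
    num (inversion i) Z k l = if k = i then (1 : Matrix (Fin g) (Fin g) ℂ) i l else Z k l := by
  have e : (Matrix.single i i (1 : ℤ)).map (Int.cast : ℤ → ℂ) = Matrix.single i i 1 := by
    ext a b; simp [Matrix.single_apply]
  have e1 : (1 : Matrix (Fin g) (Fin g) ℤ).map (Int.cast : ℤ → ℂ) = 1 := by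
    simp
  have e2 : num (inversion i) Z = (1 - Matrix.single i i 1) * Z + Matrix.single i i 1 := by
    simp only [num, blockA, blockB, inversion, toBlocks_fromBlocks₁₁, toBlocks_fromBlocks₁₂]
    rw [Matrix.map_sub _ (by simp), e1, ← e]
  rw [e2, Matrix.sub_mul]
  by_cases h : k = i
  · subst h
    simp [Matrix.single_apply, Matrix.one_apply]
  · simp [h, Ne.symm h, Matrix.single_mul_apply_of_ne]

/-- The denominator is the identity matrix with its `i`-th row replaced, so Cramer's rule for the
identity reads off the determinant. -/
theorem autFactor_inversion (i : Fin g) (Z : siegelHalfSpace g) :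
    autFactor (inversion i) Z = -Z.1 i i := by
  have h : denom (inversion i) Z.1 =
      (1 : Matrix (Fin g) (Fin g) ℂ).updateRow i (fun l => -Z.1 i l) := by
    ext k l
    rw [denom_inversion, Matrix.updateRow_apply]
  rw [autFactor, h, ← Matrix.cramer_transpose_apply, transpose_one, Matrix.cramer_one]
  rfl

theorem symm_apply (Z : siegelHalfSpace g) (i j : Fin g) : Z.1 i j = Z.1 j i := by
  conv_lhs => rw [← Z.2.1]
  rfl

theorem im_diag_pos (Z : siegelHalfSpace g) (i : Fin g) : 0 < (Z.1 i i).im := by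
  simpa using Z.2.2.diag_pos (i := i)

theorem diag_ne_zero (Z : siegelHalfSpace g) (i : Fin g) : Z.1 i i ≠ 0 := by
  intro h
  have := im_diag_pos Z i
  rw [h] at this
  simp at this

/-- The image of `Z` under the inversion in the `i`-th coordinate. -/
noncomputable def inverted (i : Fin g) (Z : Matrix (Fin g) (Fin g) ℂ) :
    Matrix (Fin g) (Fin g) ℂ :=
  Matrix.of fun k l =>
    if k = i then (if l = i then -1 / Z i i else -Z i l / Z i i)
    else (if l = i then -Z k i / Z i i else Z k l - Z k i * Z i l / Z i i)

theorem moebius_inversion (i : Fin g) (Z : siegelHalfSpace g) :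
    (moebius (inversion i) Z).1 = inverted i Z.1 := by
  apply moebius_eq_of_mul_denom
  have h0 := diag_ne_zero Z i
  ext k l
  rw [Matrix.mul_apply, ← Finset.add_sum_erase _ _ (Finset.mem_univ i), num_inversion]
  -- The rows of the denominator other than the `i`-th are those of the identity, so at most the
  -- term `x = l` survives.
  have e : ∑ x ∈ Finset.univ.erase i, inverted i Z.1 k x * denom (inversion i) Z.1 x l =
      if l = i then 0 else inverted i Z.1 k l := by
    split_ifs with h
    · refine Finset.sum_eq_zero fun x hx => ?_
      have hx := Finset.ne_of_mem_erase hx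
      rw [denom_inversion, if_neg hx, h, Matrix.one_apply_ne hx, mul_zero]
    · rw [Finset.sum_eq_single l]
      · rw [denom_inversion, if_neg h, Matrix.one_apply_eq, mul_one]
      · intro x hx hxl
        have hx := Finset.ne_of_mem_erase hx
        rw [denom_inversion, if_neg hx, Matrix.one_apply_ne hxl, mul_zero]
      · intro hl
        exact absurd (Finset.mem_erase.2 ⟨h, Finset.mem_univ _⟩) hl
  rw [e, denom_inversion, if_pos rfl]
  by_cases hk : k = i
  · by_cases hl : l = i
    · subst hk; subst hl
      simp [inverted]; field_simp
    · subst hk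
      simp [inverted, hl, Ne.symm hl]; field_simp; ring
  · by_cases hl : l = i
    · subst hl
      simp [inverted, hk]; field_simp
    · simp [inverted, hk, hl]; field_simp; ring

end Elements
-- Symplectic transvections.
section Transvections

variable {g : ℕ}

/-- The standard symplectic form on `ℤ ^ (2 g)`. -/
def symplecticForm (x y : Fin g ⊕ Fin g → ℤ) : ℤ := (J (Fin g) ℤ *ᵥ x) ⬝ᵥ y

theorem symplecticForm_add_left (x x' y : Fin g ⊕ Fin g → ℤ) :
    symplecticForm (x + x') y = symplecticForm x y + symplecticForm x' y := by
  simp [symplecticForm, Matrix.mulVec_add]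

theorem symplecticForm_add_right (x y y' : Fin g ⊕ Fin g → ℤ) :
    symplecticForm x (y + y') = symplecticForm x y + symplecticForm x y' := by
  simp [symplecticForm]

theorem symplecticForm_smul_right (c : ℤ) (x y : Fin g ⊕ Fin g → ℤ) :
    symplecticForm x (c • y) = c * symplecticForm x y := by
  rw [symplecticForm, dotProduct_smul, smul_eq_mul, symplecticForm]

theorem J_mulVec_inl (x : Fin g ⊕ Fin g → ℤ) (i : Fin g) :
    (J (Fin g) ℤ *ᵥ x) (Sum.inl i) = -x (Sum.inr i) := by
  rw [J, ← Sum.elim_comp_inl_inr x, fromBlocks_mulVec]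
  simp [Matrix.neg_mulVec]

theorem J_mulVec_inr (x : Fin g ⊕ Fin g → ℤ) (i : Fin g) :
    (J (Fin g) ℤ *ᵥ x) (Sum.inr i) = x (Sum.inl i) := by
  rw [J, ← Sum.elim_comp_inl_inr x, fromBlocks_mulVec]
  simp

theorem symplecticForm_eq_sum (x y : Fin g ⊕ Fin g → ℤ) :
    symplecticForm x y = ∑ i, (x (Sum.inl i) * y (Sum.inr i) - x (Sum.inr i) * y (Sum.inl i)) := by
  rw [symplecticForm, dotProduct, Fintype.sum_sum_type, ← Finset.sum_add_distrib]
  refine Finset.sum_congr rfl fun i _ => ?_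
  rw [J_mulVec_inl, J_mulVec_inr]
  ring

theorem symplecticForm_self (x : Fin g ⊕ Fin g → ℤ) : symplecticForm x x = 0 := by
  rw [symplecticForm_eq_sum]
  exact Finset.sum_eq_zero fun i _ => by ring

theorem symplecticForm_comm (x y : Fin g ⊕ Fin g → ℤ) :
    symplecticForm x y = -symplecticForm y x := by
  rw [symplecticForm_eq_sum, symplecticForm_eq_sum, ← Finset.sum_neg_distrib]
  exact Finset.sum_congr rfl fun i _ => by ring

theorem symplecticForm_mulVec (M : ModularGroup g) (x y : Fin g ⊕ Fin g → ℤ) :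
    symplecticForm (M.1 *ᵥ x) (M.1 *ᵥ y) = symplecticForm x y := by
  have h := SymplecticGroup.mem_iff'.1 M.2
  rw [symplecticForm, symplecticForm, Matrix.dotProduct_mulVec, ← Matrix.mulVec_transpose,
    Matrix.mulVec_mulVec, Matrix.mulVec_mulVec, h]

/-- The transvection `x ↦ x + c ω(u, x) u`. -/
def symplecticTransvection (c : ℤ) (u : Fin g ⊕ Fin g → ℤ) : ModularGroup g :=
  ⟨1 + c • vecMulVec u (J (Fin g) ℤ *ᵥ u), by
    -- In the expansion of `M J Mᵗ` the two terms linear in `c` are opposite multiples of `u uᵗ`,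
    -- and the quadratic one contains the factor `ω(u, u) = 0`.
    have hu : (J (Fin g) ℤ *ᵥ u) ⬝ᵥ u = 0 := symplecticForm_self u
    rw [SymplecticGroup.mem_iff, transpose_add, transpose_one, transpose_smul,
      transpose_vecMulVec]
    have h1 : vecMulVec u (J (Fin g) ℤ *ᵥ u) * J (Fin g) ℤ = vecMulVec u u := by
      rw [Matrix.vecMulVec_mul, ← Matrix.mulVec_transpose, Matrix.mulVec_mulVec, J_transpose,
        Matrix.neg_mul, J_squared, neg_neg, one_mulVec]
    have h2 : J (Fin g) ℤ * vecMulVec (J (Fin g) ℤ *ᵥ u) u = -vecMulVec u u := by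
      rw [Matrix.mul_vecMulVec, Matrix.mulVec_mulVec, J_squared, Matrix.neg_mulVec, one_mulVec,
        Matrix.neg_vecMulVec]
    have h3 : vecMulVec u u * vecMulVec (J (Fin g) ℤ *ᵥ u) u = 0 := by
      rw [Matrix.vecMulVec_mul_vecMulVec, dotProduct_comm, hu, zero_smul, Matrix.vecMulVec_zero]
    rw [Matrix.add_mul, Matrix.one_mul, Matrix.smul_mul, h1, Matrix.mul_add, Matrix.mul_one,
      Matrix.add_mul, Matrix.mul_smul, Matrix.mul_smul, Matrix.smul_mul, h2, h3]
    simp⟩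

theorem symplecticTransvection_mulVec (c : ℤ) (u x : Fin g ⊕ Fin g → ℤ) :
    (symplecticTransvection c u).1 *ᵥ x = x + (c * symplecticForm u x) • u := by
  rw [symplecticTransvection, Matrix.add_mulVec, one_mulVec, Matrix.smul_mulVec,
    Matrix.vecMulVec_mulVec, symplecticForm, mul_smul]
  simp

theorem modularGroup_ext {M N : ModularGroup g}
    (h : ∀ x, M.1 *ᵥ x = N.1 *ᵥ x) : M = N :=
  Subtype.ext (Matrix.ext_of_mulVec_single fun _ => h _)

theorem mul_mulVec (M N : ModularGroup g) (x : Fin g ⊕ Fin g → ℤ) :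
    (M * N).1 *ᵥ x = M.1 *ᵥ (N.1 *ᵥ x) := by
  rw [Matrix.mulVec_mulVec]; rfl

theorem one_mulVec' (x : Fin g ⊕ Fin g → ℤ) : (1 : ModularGroup g).1 *ᵥ x = x :=
  Matrix.one_mulVec x

theorem inv_mulVec_mulVec (M : ModularGroup g) (x : Fin g ⊕ Fin g → ℤ) :
    (M⁻¹).1 *ᵥ (M.1 *ᵥ x) = x := by
  rw [← mul_mulVec, inv_mul_cancel, one_mulVec']

theorem mulVec_inv_mulVec (M : ModularGroup g) (x : Fin g ⊕ Fin g → ℤ) :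
    M.1 *ᵥ ((M⁻¹).1 *ᵥ x) = x := by
  rw [← mul_mulVec, mul_inv_cancel, one_mulVec']

theorem symplecticTransvection_zero (u : Fin g ⊕ Fin g → ℤ) :
    symplecticTransvection 0 u = 1 :=
  modularGroup_ext fun x => by simp [symplecticTransvection_mulVec]

theorem symplecticTransvection_add (c d : ℤ) (u : Fin g ⊕ Fin g → ℤ) :
    symplecticTransvection (c + d) u = symplecticTransvection c u * symplecticTransvection d u :=
  modularGroup_ext fun x => by
    rw [mul_mulVec]
    simp only [symplecticTransvection_mulVec, symplecticForm_add_right,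
      symplecticForm_smul_right, symplecticForm_self]
    rw [add_assoc, ← add_smul]
    congr 2
    ring

theorem symplecticTransvection_inv (c : ℤ) (u : Fin g ⊕ Fin g → ℤ) :
    (symplecticTransvection c u)⁻¹ = symplecticTransvection (-c) u := by
  rw [inv_eq_iff_mul_eq_one, ← symplecticTransvection_add, add_neg_cancel,
    symplecticTransvection_zero]

theorem symplecticTransvection_neg (c : ℤ) (u : Fin g ⊕ Fin g → ℤ) :
    symplecticTransvection c (-u) = symplecticTransvection c u :=
  modularGroup_ext fun x => by
    have : symplecticForm (-u) x = -symplecticForm u x := by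
      simp [symplecticForm, Matrix.mulVec_neg]
    simp [symplecticTransvection_mulVec, this]

/-- Invariance of the form under `M`. This carries statements about one transvection to those along
other vectors in its orbit. -/
theorem conj_symplecticTransvection (M : ModularGroup g) (c : ℤ) (u : Fin g ⊕ Fin g → ℤ) :
    M * symplecticTransvection c u * M⁻¹ = symplecticTransvection c (M.1 *ᵥ u) :=
  modularGroup_ext fun x => by
    rw [mul_mulVec, mul_mulVec]
    simp only [symplecticTransvection_mulVec]
    rw [Matrix.mulVec_add, mulVec_inv_mulVec, Matrix.mulVec_smul,
      ← symplecticForm_mulVec M u, mulVec_inv_mulVec]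

theorem mem_principalCongruenceSubgroup_iff {l : ℕ} {M : ModularGroup g} :
    M ∈ principalCongruenceSubgroup g l ↔ M.1.map (Int.castRingHom (ZMod l)) = 1 := by
  rw [principalCongruenceSubgroup, MonoidHom.mem_ker, Subtype.ext_iff]
  rfl

theorem symplecticTransvection_mem_principalCongruenceSubgroup (l : ℕ)
    (u : Fin g ⊕ Fin g → ℤ) : symplecticTransvection l u ∈ principalCongruenceSubgroup g l := by
  rw [mem_principalCongruenceSubgroup_iff, symplecticTransvection]
  ext a b
  have h : ((1 + (l : ℤ) • vecMulVec u (J (Fin g) ℤ *ᵥ u) : Matrix _ _ ℤ) a b) =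
      (1 : Matrix _ _ ℤ) a b + l * vecMulVec u (J (Fin g) ℤ *ᵥ u) a b := rfl
  change Int.castRingHom (ZMod l) ((1 + (l : ℤ) • vecMulVec u (J (Fin g) ℤ *ᵥ u)) a b) = _
  rw [h]
  simp [Matrix.one_apply]

theorem dvd_mulVec_sub {l : ℕ} {M : ModularGroup g} (hM : M ∈ principalCongruenceSubgroup g l)
    (x : Fin g ⊕ Fin g → ℤ) (a : Fin g ⊕ Fin g) : (l : ℤ) ∣ (M.1 *ᵥ x) a - x a := by
  rw [mem_principalCongruenceSubgroup_iff] at hM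
  rw [← ZMod.intCast_zmod_eq_zero_iff_dvd, Int.cast_sub, sub_eq_zero]
  have := congrFun (RingHom.map_mulVec (Int.castRingHom (ZMod l)) M.1 x a |>.symm |> fun h =>
    (funext fun _ => h : (fun _ : Unit => _) = fun _ => _)) ()
  simp only [hM, one_mulVec] at this
  simpa using this.symm

end Transvections

/-! ### Generation of the level two subgroup by squares of transvections. -/

section Generation

variable {g : ℕ}

/-- The standard basis vectors. -/
abbrev stdVec (a : Fin g ⊕ Fin g) : Fin g ⊕ Fin g → ℤ := Pi.single a 1

/-- The index in `Fin g` of a basis vector. -/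
def baseIndex : Fin g ⊕ Fin g → Fin g := Sum.elim id id

/-- The sign of the pairing of a basis vector with its dual basis vector. -/
def dualSign : Fin g ⊕ Fin g → ℤ := Sum.elim (fun _ => 1) (fun _ => -1)

theorem dualSign_mul_self (a : Fin g ⊕ Fin g) : dualSign a * dualSign a = 1 := by
  rcases a with i | i <;> simp [dualSign]

theorem dualSign_swap (a : Fin g ⊕ Fin g) : dualSign a.swap = -dualSign a := by
  rcases a with i | i <;> simp [dualSign]

theorem swap_ne (a : Fin g ⊕ Fin g) : a.swap ≠ a := by
  rcases a with i | i <;> simp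

theorem eq_or_eq_swap {a b : Fin g ⊕ Fin g} (h : baseIndex a = baseIndex b) :
    a = b ∨ a = b.swap := by
  rcases a with i | i <;> rcases b with j | j <;> simp_all [baseIndex]

theorem symplecticForm_stdVec (a : Fin g ⊕ Fin g) (x : Fin g ⊕ Fin g → ℤ) :
    symplecticForm (stdVec a) x = dualSign a * x a.swap := by
  rw [symplecticForm_eq_sum]
  rcases a with i | i
  · rw [Finset.sum_eq_single i (fun j _ hj => by simp [stdVec, hj]) (by simp)]
    simp [stdVec, dualSign]
  · rw [Finset.sum_eq_single i (fun j _ hj => by simp [stdVec, hj]) (by simp)]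
    simp [stdVec, dualSign]

theorem dvd_mulVec {d : ℤ} (M : Matrix (Fin g ⊕ Fin g) (Fin g ⊕ Fin g) ℤ)
    {x : Fin g ⊕ Fin g → ℤ} (hx : ∀ b, d ∣ x b) (a : Fin g ⊕ Fin g) : d ∣ (M *ᵥ x) a := by
  rw [Matrix.mulVec, dotProduct]
  exact Finset.dvd_sum fun c _ => Dvd.dvd.mul_left (hx c) _

/-- The pointwise stabilizer of a set of basis vectors. -/
def basisFixator (B : Set (Fin g ⊕ Fin g)) : Subgroup (ModularGroup g) where
  carrier := {M | ∀ b ∈ B, M.1 *ᵥ stdVec b = stdVec b}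
  mul_mem' hM hN b hb := by rw [mul_mulVec, hN b hb, hM b hb]
  one_mem' b _ := one_mulVec' _
  inv_mem' {M} hM b hb := by
    conv_lhs => rw [← hM b hb]
    exact inv_mulVec_mulVec M _

/-- Up to sign, the coordinate at `a` is the pairing with the basis vector at `a.swap`. If that
vector is fixed, invariance of the form fixes the coordinate. -/
theorem mulVec_apply_of_mem_basisFixator {B : Set (Fin g ⊕ Fin g)} {M : ModularGroup g}
    (hM : M ∈ basisFixator B) {a : Fin g ⊕ Fin g} (ha : a.swap ∈ B) (x : Fin g ⊕ Fin g → ℤ) :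
    (M.1 *ᵥ x) a = x a := by
  have h := symplecticForm_mulVec M (stdVec a.swap) x
  rw [hM _ ha, symplecticForm_stdVec, symplecticForm_stdVec, Sum.swap_swap] at h
  have h0 : dualSign a.swap ≠ 0 := by
    rcases a with i | i <;> simp [dualSign]
  exact mul_left_cancel₀ h0 h

theorem symplecticTransvection_mem_basisFixator {B : Set (Fin g ⊕ Fin g)} (c : ℤ)
    {u : Fin g ⊕ Fin g → ℤ} (hu : ∀ b ∈ B, u b.swap = 0) :
    symplecticTransvection c u ∈ basisFixator B := by
  intro b hb
  rw [symplecticTransvection_mulVec, symplecticForm_comm, symplecticForm_stdVec, hu b hb]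
  simp

/-- A subgroup of the principal congruence subgroup of level two that contains sufficiently many
squares of transvections. -/
structure HasSquares (H : Subgroup (ModularGroup g)) : Prop where
  le : H ≤ principalCongruenceSubgroup g 2
  basis : ∀ a, symplecticTransvection 2 (stdVec a) ∈ H
  add : ∀ a b, a ≠ b → symplecticTransvection 2 (stdVec a + stdVec b) ∈ H

theorem symplecticTransvection_two_mul_mem {H : Subgroup (ModularGroup g)}
    {u : Fin g ⊕ Fin g → ℤ} (hu : symplecticTransvection 2 u ∈ H) (k : ℤ) :
    symplecticTransvection (2 * k) u ∈ H := by
  induction k with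
  | zero => rw [mul_zero, symplecticTransvection_zero]; exact H.one_mem
  | succ k ih =>
    rw [mul_add, symplecticTransvection_add]
    exact H.mul_mem ih (by simpa using hu)
  | pred k ih =>
    rw [mul_sub, sub_eq_add_neg, symplecticTransvection_add]
    refine H.mul_mem ih ?_
    rw [← symplecticTransvection_inv]
    exact H.inv_mem (by simpa using hu)

/-- A row operation for the Euclidean algorithm: an even multiple of one coordinate is added to its
dual coordinate. The factor `dualSign a` absorbs the sign of the pairing. -/
theorem exists_elementary_basis {H : Subgroup (ModularGroup g)} (hH : HasSquares H)
    {B : Set (Fin g ⊕ Fin g)} (a : Fin g ⊕ Fin g) (ha : a.swap ∉ B) (k : ℤ) :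
    ∃ p ∈ H ⊓ basisFixator B, ∀ x, p.1 *ᵥ x = x + (2 * k * x a.swap) • stdVec a := by
  refine ⟨symplecticTransvection (2 * (k * dualSign a)) (stdVec a),
    ⟨symplecticTransvection_two_mul_mem (hH.basis a) _,
      symplecticTransvection_mem_basisFixator _ fun b hb => ?_⟩, fun x => ?_⟩
  · refine Pi.single_eq_of_ne ?_ _
    rintro rfl
    rw [Sum.swap_swap] at ha
    exact ha hb
  · rw [symplecticTransvection_mulVec, symplecticForm_stdVec]
    congr 2
    linear_combination 2 * k * x a.swap * dualSign_mul_self a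

/-- For orthogonal `u` and `v`, dividing the transvection along `u + v` by those along `u` and `v`
leaves only the mixed part `ω(u, x) v + ω(v, x) u`. -/
theorem exists_elementary_pair {H : Subgroup (ModularGroup g)} (hH : HasSquares H)
    {B : Set (Fin g ⊕ Fin g)} (a b : Fin g ⊕ Fin g) (hab : baseIndex a ≠ baseIndex b)
    (ha : a.swap ∉ B) (hb : b.swap ∉ B) (k : ℤ) :
    ∃ p ∈ H ⊓ basisFixator B, ∀ x, p.1 *ᵥ x =
      x + (2 * k * x a.swap) • stdVec b
        + (2 * k * dualSign a * dualSign b * x b.swap) • stdVec a := by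
  have hne : a ≠ b := fun h => hab (by rw [h])
  have hne' : b ≠ a.swap := by
    rintro rfl
    exact hab (by rcases a with i | i <;> rfl)
  have hne'' : a ≠ b.swap := by
    rintro rfl
    exact hab (by rcases b with i | i <;> rfl)
  have hfa : ∀ c ∈ B, stdVec a c.swap = 0 := fun c hc => by
    refine Pi.single_eq_of_ne ?_ _
    rintro rfl
    rw [Sum.swap_swap] at ha
    exact ha hc
  have hfb : ∀ c ∈ B, stdVec b c.swap = 0 := fun c hc => by
    refine Pi.single_eq_of_ne ?_ _
    rintro rfl
    rw [Sum.swap_swap] at hb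
    exact hb hc
  refine ⟨symplecticTransvection (2 * (k * dualSign a)) (stdVec a + stdVec b) *
    (symplecticTransvection (2 * -(k * dualSign a)) (stdVec a) *
      symplecticTransvection (2 * -(k * dualSign a)) (stdVec b)),
    Subgroup.mul_mem _ ?_ (Subgroup.mul_mem _ ?_ ?_), fun x => ?_⟩
  · exact ⟨symplecticTransvection_two_mul_mem (hH.add a b hne) _,
      symplecticTransvection_mem_basisFixator _ fun c hc => by
        rw [Pi.add_apply, hfa c hc, hfb c hc, add_zero]⟩
  · exact ⟨symplecticTransvection_two_mul_mem (hH.basis a) _,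
      symplecticTransvection_mem_basisFixator _ hfa⟩
  · exact ⟨symplecticTransvection_two_mul_mem (hH.basis b) _,
      symplecticTransvection_mem_basisFixator _ hfb⟩
  · rw [mul_mulVec, mul_mulVec]
    have e1 : stdVec a b.swap = 0 := Pi.single_eq_of_ne hne''.symm _
    have e2 : stdVec b a.swap = 0 := Pi.single_eq_of_ne hne'.symm _
    have e3 : stdVec a a.swap = 0 := Pi.single_eq_of_ne (swap_ne a) _
    have e4 : stdVec b b.swap = 0 := Pi.single_eq_of_ne (swap_ne b) _
    simp only [symplecticTransvection_mulVec, symplecticForm_add_left, symplecticForm_add_right,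
      symplecticForm_smul_right, symplecticForm_stdVec, e1, e2, e3, e4]
    have h := dualSign_mul_self a
    ext c
    simp only [Pi.add_apply, Pi.smul_apply, smul_eq_mul]
    linear_combination 2 * k * x a.swap * stdVec b c * h

/-- If `b` is dual to `a`, one transvection suffices. Otherwise the mixed operation is applied to
`a.swap` and `b`; its second change falls on the coordinate `a.swap`, which is neither `a` nor `b`.
-/
theorem exists_elementary {H : Subgroup (ModularGroup g)} (hH : HasSquares H)
    {B : Set (Fin g ⊕ Fin g)} (hB : ∀ b, b.swap ∈ B → b ∈ B) {a b : Fin g ⊕ Fin g} (hab : a ≠ b)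
    (ha : a ∉ B) (hb : b ∉ B) (k : ℤ) :
    ∃ p ∈ H ⊓ basisFixator B, ∀ x, (p.1 *ᵥ x) b = x b + 2 * k * x a ∧ (p.1 *ᵥ x) a = x a := by
  by_cases h : baseIndex b = baseIndex a
  · obtain rfl : b = a.swap := (eq_or_eq_swap h).resolve_left hab.symm
    obtain ⟨p, hp, h⟩ := exists_elementary_basis hH (B := B) a.swap
      (by rwa [Sum.swap_swap]) k
    refine ⟨p, hp, fun x => ?_⟩
    rw [h x]
    simp [hab]
  · have h' : baseIndex a.swap ≠ baseIndex b := by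
      intro e; apply h; rw [← e]; rcases a with i | i <;> rfl
    have h1 : b ≠ a.swap := fun e => h (by rw [e]; rcases a with i | i <;> rfl)
    obtain ⟨p, hp, h⟩ := exists_elementary_pair hH (B := B) a.swap b h'
      (by rwa [Sum.swap_swap]) (fun hc => hb (hB b hc)) k
    refine ⟨p, hp, fun x => ?_⟩
    rw [h x]
    have h2 := swap_ne a
    simp [hab, h1, h2.symm]

/-- Reduction of a vector with coordinate one at `a` to a basis vector. -/
theorem exists_clear {H : Subgroup (ModularGroup g)} (hH : HasSquares H)
    {B : Set (Fin g ⊕ Fin g)} {a : Fin g ⊕ Fin g} (ha : a ∉ B) (v : Fin g ⊕ Fin g → ℤ)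
    (hva : v a = 1) (hv : ∀ b, b ≠ a → 2 ∣ v b)
    (hvB : ∀ b, baseIndex b ≠ baseIndex a → b.swap ∈ B → v b = 0) :
    ∃ h ∈ H ⊓ basisFixator B, h.1 *ᵥ v = stdVec a := by
  -- The coordinates outside the dual pair of `a` are cleared one by one. Each operation may disturb
  -- the coordinate at `a.swap`, which is therefore cleared last.
  have key : ∀ S : Finset (Fin g ⊕ Fin g), ∃ h ∈ H ⊓ basisFixator B, (h.1 *ᵥ v) a = 1 ∧
      (∀ b, b ≠ a → 2 ∣ (h.1 *ᵥ v) b) ∧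
      (∀ b, baseIndex b ≠ baseIndex a → b.swap ∈ B → (h.1 *ᵥ v) b = 0) ∧
      ∀ b ∈ S, baseIndex b ≠ baseIndex a → (h.1 *ᵥ v) b = 0 := by
    intro S
    induction S using Finset.induction_on with
    | empty =>
      exact ⟨1, Subgroup.one_mem _, by rwa [one_mulVec'], by rwa [one_mulVec'],
        by rwa [one_mulVec'], by simp⟩
    | insert c S hc ih =>
      obtain ⟨h, hh, h1, h2, h3, h4⟩ := ih
      -- When `c.swap ∈ B` the operation would not fix `B`, but then the coordinate at `c` is zero
      -- already.
      by_cases hca : baseIndex c = baseIndex a ∨ c.swap ∈ B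
      · refine ⟨h, hh, h1, h2, h3, fun b hb hba => ?_⟩
        rcases Finset.mem_insert.1 hb with rfl | hb
        · exact h3 b hba (hca.resolve_left hba)
        · exact h4 b hb hba
      · push Not at hca
        have hne : c ≠ a := fun e => hca.1 (by rw [e])
        obtain ⟨k, hk⟩ := h2 c hne
        have hidx : baseIndex a.swap = baseIndex a := by rcases a with i | i <;> rfl
        obtain ⟨p, hp, hp'⟩ := exists_elementary_pair hH (B := B) a.swap c
          (by rw [hidx]; exact hca.1.symm) (by rwa [Sum.swap_swap]) hca.2 (-k)
        have e : ∀ b, ((p * h).1 *ᵥ v) b = (h.1 *ᵥ v) b + (2 * -k) * stdVec c b +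
            (2 * -k * dualSign a.swap * dualSign c * (h.1 *ᵥ v) c.swap) * stdVec a.swap b := by
          intro b
          rw [mul_mulVec, hp', Sum.swap_swap, h1]
          simp
        have e' : ∀ b, baseIndex b ≠ baseIndex a →
            ((p * h).1 *ᵥ v) b = (h.1 *ᵥ v) b + (2 * -k) * stdVec c b := by
          intro b hb
          have hba : b ≠ a.swap := by
            rintro rfl
            exact hb hidx
          rw [e, stdVec, stdVec, Pi.single_eq_of_ne hba, mul_zero, add_zero]
        refine ⟨p * h, Subgroup.mul_mem _ hp hh, ?_, fun b hb => ?_, fun b hb hbB => ?_,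
          fun b hb hba => ?_⟩
        · rw [e, stdVec, stdVec, Pi.single_eq_of_ne hne.symm, Pi.single_eq_of_ne (swap_ne a).symm,
            h1, mul_zero, mul_zero, add_zero, add_zero]
        · rw [e]
          refine dvd_add (dvd_add (h2 b hb) ?_) ?_
          · exact Dvd.dvd.mul_right (Dvd.intro _ rfl) _
          · simp only [mul_assoc]
            exact Dvd.intro _ rfl
        · rw [e' b hb, h3 b hb hbB, stdVec, Pi.single_eq_of_ne]
          · simp
          · rintro rfl
            exact hca.2 hbB
        · rw [e' b hba]
          by_cases hbc : b = c
          · rw [hbc, hk, stdVec, Pi.single_eq_same]; ring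
          · have hbS := (Finset.mem_insert.1 hb).resolve_left hbc
            simp [h4 b hbS hba, hbc]
  obtain ⟨h, hh, h1, h2, -, h4⟩ := key Finset.univ
  obtain ⟨k, hk⟩ := h2 a.swap (swap_ne a)
  obtain ⟨p, hp, hp'⟩ := exists_elementary_basis hH (B := B) a.swap (by rwa [Sum.swap_swap]) (-k)
  refine ⟨p * h, Subgroup.mul_mem _ hp hh, ?_⟩
  rw [mul_mulVec, hp', Sum.swap_swap, h1]
  ext b
  by_cases hb : baseIndex b = baseIndex a
  · rcases eq_or_eq_swap hb with rfl | rfl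
    · simp [h1, (swap_ne b).symm]
    · simp [hk, swap_ne a]
  · have hba : b ≠ a := fun e => hb (by rw [e])
    have hba' : b ≠ a.swap := fun e => hb (by rw [e]; rcases a with i | i <;> rfl)
    simp [h4 b (Finset.mem_univ _) hb, hba, hba']

theorem exists_abs_add_two_mul_le (x y : ℤ) (hx : x ≠ 0) : ∃ k : ℤ, |y + 2 * k * x| ≤ |x| := by
  -- Dividing `y + |x|` by `2 |x|` gives a remainder that, shifted back by `|x|`, lies in `[-|x|,
  -- |x|)`. The sign converts multiples of `|x|` into multiples of `x`.
  refine ⟨-((y + |x|) / (2 * |x|)) * SignType.sign x, ?_⟩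
  have hx' : 0 < |x| := abs_pos.2 hx
  have e : y + 2 * (-((y + |x|) / (2 * |x|)) * SignType.sign x) * x
      = (y + |x|) % (2 * |x|) - |x| := by
    rw [Int.emod_def, ← sign_mul_self x]
    ring
  rw [e, abs_le]
  have h1 := Int.emod_nonneg (y + |x|) (by positivity : (2 * |x|) ≠ 0)
  have h2 := Int.emod_lt_of_pos (y + |x|) (by positivity : 0 < 2 * |x|)
  constructor <;> linarith

/-- The even Euclidean algorithm for a column of a matrix in the principal congruence subgroup. -/
theorem exists_reduce {H : Subgroup (ModularGroup g)} (hH : HasSquares H)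
    {B : Set (Fin g ⊕ Fin g)} (hB : ∀ b, b.swap ∈ B → b ∈ B) {a : Fin g ⊕ Fin g} (ha : a ∉ B)
    (v : Fin g ⊕ Fin g → ℤ) (hva : ¬ 2 ∣ v a) (hv : ∀ b, b ≠ a → 2 ∣ v b)
    (hvB : ∀ b ∈ B, v b = 0) (hprim : ∀ d, (∀ b, d ∣ v b) → IsUnit d) :
    ∃ h ∈ H ⊓ basisFixator B, h.1 *ᵥ v = stdVec a := by
  have hB' : ∀ b ∈ B, b.swap ∈ B := fun b hb => hB _ (by rwa [Sum.swap_swap])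
  have hle : ∀ h ∈ H ⊓ basisFixator B, ∀ b, 2 ∣ (h.1 *ᵥ v) b - v b :=
    fun h hh b => by exact_mod_cast dvd_mulVec_sub (hH.le hh.1) v b
  have hodd : ∀ h ∈ H ⊓ basisFixator B, ¬ 2 ∣ (h.1 *ᵥ v) a := fun h hh hd => by
    have := hle h hh a
    omega
  have heven : ∀ h ∈ H ⊓ basisFixator B, ∀ b, b ≠ a → 2 ∣ (h.1 *ᵥ v) b := fun h hh b hb => by
    have h1 := hle h hh b
    have h2 := hv b hb
    omega
  have hzero : ∀ h ∈ H ⊓ basisFixator B, ∀ b ∈ B, (h.1 *ᵥ v) b = 0 := fun h hh b hb => by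
    rw [mulVec_apply_of_mem_basisFixator hh.2 (hB' b hb), hvB b hb]
  -- Descent: choose an orbit vector whose odd coordinate at `a` has least absolute value.
  obtain ⟨h, hh, hmin⟩ : ∃ h ∈ H ⊓ basisFixator B, ∀ h' ∈ H ⊓ basisFixator B,
      ((h.1 *ᵥ v) a).natAbs ≤ ((h'.1 *ᵥ v) a).natAbs := by
    have hne : {n | ∃ h ∈ H ⊓ basisFixator B, ((h.1 *ᵥ v) a).natAbs = n}.Nonempty :=
      ⟨_, 1, Subgroup.one_mem _, rfl⟩
    obtain ⟨h, hh, he⟩ := Nat.sInf_mem hne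
    exact ⟨h, hh, fun h' hh' => he ▸ Nat.sInf_le ⟨h', hh', rfl⟩⟩
  -- Reduce the coordinate at `b` by the one at `a`. If the result is nonzero, reduce the coordinate
  -- at `a` by it in turn; minimality forces equality of absolute values throughout, although one
  -- number is odd and the other even.
  have hdvd : ∀ b, b ≠ a → ∃ k, (h.1 *ᵥ v) b = 2 * k * (h.1 *ᵥ v) a := by
    intro b hba
    by_cases hbB : b ∈ B
    · exact ⟨0, by rw [hzero h hh b hbB]; ring⟩
    have hx : (h.1 *ᵥ v) a ≠ 0 := fun e => hodd h hh (by rw [e]; exact dvd_zero _)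
    obtain ⟨k, hk⟩ := exists_abs_add_two_mul_le ((h.1 *ᵥ v) a) ((h.1 *ᵥ v) b) hx
    obtain ⟨p, hp, hp'⟩ := exists_elementary hH hB hba.symm ha hbB k
    have hph := Subgroup.mul_mem _ hp hh
    obtain ⟨e1, e2⟩ := hp' (h.1 *ᵥ v)
    rw [← mul_mulVec] at e1 e2
    rw [← e1] at hk
    by_cases hy : ((p * h).1 *ᵥ v) b = 0
    · exact ⟨-k, by rw [e1] at hy; linarith⟩
    exfalso
    obtain ⟨m, hm⟩ := exists_abs_add_two_mul_le _ (((p * h).1 *ᵥ v) a) hy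
    obtain ⟨q, hq, hq'⟩ := exists_elementary hH hB hba hbB ha m
    have e3 := (hq' ((p * h).1 *ᵥ v)).1
    rw [← mul_mulVec] at e3
    rw [← e3] at hm
    have h1 := Int.ofNat_le.2 (hmin _ (Subgroup.mul_mem _ hq hph))
    rw [Int.natCast_natAbs, Int.natCast_natAbs] at h1
    have h2 := hodd h hh
    have h3 := heven _ hph b hba
    have h4 := le_antisymm hk (h1.trans hm)
    rcases abs_eq_abs.1 h4 with h4 | h4 <;> omega
  have hunit : IsUnit ((h.1 *ᵥ v) a) := by
    apply hprim
    intro b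
    have hd : ∀ c, (h.1 *ᵥ v) a ∣ (h.1 *ᵥ v) c := fun c => by
      by_cases hc : c = a
      · rw [hc]
      · obtain ⟨k, hk⟩ := hdvd c hc
        exact ⟨2 * k, by rw [hk]; ring⟩
    conv_rhs => rw [← inv_mulVec_mulVec h v]
    exact dvd_mulVec _ hd b
  obtain ⟨h₁, hh₁, hone⟩ : ∃ h ∈ H ⊓ basisFixator B, (h.1 *ᵥ v) a = 1 := by
    rcases Int.isUnit_iff.1 hunit with h1 | h1
    · exact ⟨h, hh, h1⟩
    obtain ⟨k, hk⟩ := hdvd a.swap (swap_ne a)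
    have hasw : a.swap ∉ B := fun hc => ha (hB a hc)
    obtain ⟨p, hp, hp'⟩ := exists_elementary hH hB (swap_ne a).symm ha hasw (-k)
    obtain ⟨e1, e2⟩ := hp' (h.1 *ᵥ v)
    rw [← mul_mulVec] at e1 e2
    have hph := Subgroup.mul_mem _ hp hh
    -- After `p` the coordinates at `a` and `a.swap` are `-1` and `0`; this transvection adds `2` to
    -- both, so the first becomes `1`.
    refine ⟨symplecticTransvection (2 * dualSign a) (stdVec a + stdVec a.swap) * (p * h),
      Subgroup.mul_mem _ ⟨symplecticTransvection_two_mul_mem (hH.add _ _ (swap_ne a).symm) _,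
        symplecticTransvection_mem_basisFixator _ fun b hb => ?_⟩ hph, ?_⟩
    · have h1 : b.swap ≠ a := by
        rintro rfl
        exact ha (hB' b hb)
      have h2 : b.swap ≠ a.swap := fun e => ha (by
        rw [← Sum.swap_swap a, ← e, Sum.swap_swap]; exact hb)
      simp [h1, h2]
    · rw [mul_mulVec, symplecticTransvection_mulVec, symplecticForm_add_left,
        symplecticForm_stdVec, symplecticForm_stdVec, Sum.swap_swap, dualSign_swap]
      have e3 : ((p * h).1 *ᵥ v) a.swap = 0 := by rw [e1, hk]; ring
      simp only [Pi.add_apply, Pi.smul_apply, smul_eq_mul, e2, e3, h1, stdVec, Pi.single_eq_same,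
        Pi.single_eq_of_ne (swap_ne a).symm]
      linear_combination 2 * dualSign_mul_self a
  obtain ⟨h₂, hh₂, h3⟩ := exists_clear hH (B := B) ha (h₁.1 *ᵥ v) hone (heven h₁ hh₁)
    (fun b _ hb => hzero h₁ hh₁ b (hB b hb))
  exact ⟨h₂ * h₁, Subgroup.mul_mem _ hh₂ hh₁, by rw [mul_mulVec, h3]⟩

/-- Elimination by dual pairs: multiplying by elements of `H` makes both columns of one more index
equal to basis vectors while keeping the earlier ones fixed. A matrix fixing all pairs is the
identity. -/
theorem HasSquares.eq_principalCongruenceSubgroup {H : Subgroup (ModularGroup g)}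
    (hH : HasSquares H) : H = principalCongruenceSubgroup g 2 := by
  refine le_antisymm hH.le fun M hM => ?_
  have key : ∀ (n : ℕ) (I : Finset (Fin g)), Iᶜ.card = n →
      ∀ M ∈ principalCongruenceSubgroup g 2 ⊓ basisFixator {b | baseIndex b ∈ I}, M ∈ H := by
    intro n
    induction n with
    | zero =>
      intro I hI M hM
      have hI' : I = Finset.univ := by simpa using hI
      have : M = 1 := Subtype.ext (Matrix.ext_of_mulVec_single fun b => by
        have := hM.2 b (by simp [hI'])
        rw [this]
        exact (one_mulVec' _).symm)
      rw [this]; exact H.one_mem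
    | succ n ih =>
      intro I hI M hM
      obtain ⟨i, hi⟩ : Iᶜ.Nonempty := by
        rw [← Finset.card_pos]; omega
      have hi' : i ∉ I := by simpa using hi
      have hswap : ∀ b : Fin g ⊕ Fin g, baseIndex b.swap = baseIndex b := by
        rintro (b | b) <;> rfl
      have hcol : ∀ N ∈ principalCongruenceSubgroup g 2 ⊓ basisFixator {b | baseIndex b ∈ I},
          ∀ a : Fin g ⊕ Fin g, baseIndex a = i → ∀ b, baseIndex b ∈ I →
            (N.1 *ᵥ stdVec a) b = 0 := by
        intro N hN a ha b hb
        rw [mulVec_apply_of_mem_basisFixator hN.2 (by simpa [hswap] using hb)]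
        refine Pi.single_eq_of_ne ?_ _
        rintro rfl
        exact hi' (ha ▸ hb)
      have hmod : ∀ N ∈ principalCongruenceSubgroup g 2, ∀ a b,
          2 ∣ (N.1 *ᵥ stdVec a) b - stdVec a b := fun N hN a b => by
        exact_mod_cast dvd_mulVec_sub hN (stdVec a) b
      obtain ⟨h, hh, he⟩ := exists_reduce hH (B := {b | baseIndex b ∈ I})
        (fun b hb => by simpa [hswap] using hb) (a := Sum.inl i) hi' (M.1 *ᵥ stdVec (Sum.inl i))
        (by
          have := hmod M hM.1 (Sum.inl i) (Sum.inl i)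
          simp only [stdVec, Pi.single_eq_same] at this ⊢
          omega)
        (fun b hb => by
          have := hmod M hM.1 (Sum.inl i) b
          simp only [stdVec, Pi.single_eq_of_ne hb] at this ⊢
          omega)
        (fun b hb => hcol M hM _ rfl b hb)
        (fun d hd => by
          have : d ∣ stdVec (Sum.inl i) (Sum.inl i) := by
            conv_rhs => rw [← inv_mulVec_mulVec M (stdVec (Sum.inl i))]
            exact dvd_mulVec _ hd _
          rw [stdVec, Pi.single_eq_same] at this
          exact isUnit_of_dvd_one this)
      rw [← mul_mulVec] at he
      have hM₁ : h * M ∈ principalCongruenceSubgroup g 2 ⊓ basisFixator {b | baseIndex b ∈ I} :=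
        Subgroup.mul_mem _ ⟨hH.le hh.1, hh.2⟩ hM
      have hM₁' : h * M ∈ basisFixator {b | baseIndex b ∈ I ∨ b = Sum.inl i} := by
        rintro b (hb | rfl)
        · exact hM₁.2 b hb
        · exact he
      -- No Euclidean algorithm is needed for the second column of the pair: since the first basis
      -- vector is now fixed, invariance of the form makes the relevant coordinate equal to one.
      obtain ⟨h', hh', he'⟩ := exists_clear hH (B := {b | baseIndex b ∈ I ∨ b = Sum.inl i})
        (a := Sum.inr i) (by simpa [baseIndex] using hi') ((h * M).1 *ᵥ stdVec (Sum.inr i))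
        (by
          rw [mulVec_apply_of_mem_basisFixator hM₁' (by simp)]
          simp)
        (fun b hb => by
          have := hmod _ hM₁.1 (Sum.inr i) b
          simp only [stdVec, Pi.single_eq_of_ne hb] at this ⊢
          omega)
        (fun b hb hbB => by
          rcases hbB with hbB | hbB
          · exact hcol _ hM₁ _ rfl b (by simpa [hswap] using hbB)
          · exact absurd (by rw [← hswap, hbB]; rfl) hb)
      rw [← mul_mulVec] at he'
      have hmem : h' * (h * M) ∈ H := by
        refine ih (insert i I) ?_ _ ⟨Subgroup.mul_mem _ (hH.le hh'.1) hM₁.1, ?_⟩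
        · rw [Finset.compl_insert, Finset.card_erase_of_mem hi, hI]; rfl
        · intro b hb
          rcases Finset.mem_insert.1 hb with hb | hb
          · rcases b with j | j
            · obtain rfl : j = i := hb
              exact (Subgroup.mul_mem _ hh'.2 hM₁') _ (Or.inr rfl)
            · obtain rfl : j = i := hb
              exact he'
          · exact (Subgroup.mul_mem _ hh'.2 hM₁') _ (Or.inl hb)
      rw [Subgroup.mul_mem_cancel_left _ hh'.1, Subgroup.mul_mem_cancel_left _ hh.1] at hmem
      exact hmem
  exact key _ ∅ rfl M ⟨hM, fun b hb => by simp at hb⟩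

end Generation
-- Göpel groups, their even cosets, and affine maps preserving evenness.
section Combinatorics

variable {g : ℕ}

theorem maximal_isIsotropic_iff {G : Submodule (ZMod 2) (Characteristic g)} :
    Maximal IsIsotropic G ↔ IsIsotropic G ∧ ∀ x, (∀ n ∈ G, pairing x n = 0) → x ∈ G := by
  refine ⟨fun h => ⟨h.1, fun x => mem_of_pairing_eq_zero h⟩,
    fun h => ⟨h.1, fun G' hG' hle x hx => ?_⟩⟩
  exact h.2 x fun n hn => hG' x hx n (hle hn)

/-- The pairing as a bilinear map. -/
def pairingLin : Characteristic g →ₗ[ZMod 2] Characteristic g →ₗ[ZMod 2] ZMod 2 :=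
  LinearMap.mk₂ (ZMod 2) pairing pairing_add_left pairing_smul_left pairing_add_right
    pairing_smul_right

/-- The pairing maps the whole space onto the dual of `G`, with kernel `G` by maximality; hence `2 g
= 2 dim G`. -/
theorem finrank_gopelGroup {G : Submodule (ZMod 2) (Characteristic g)}
    (hG : Maximal IsIsotropic G) : Module.finrank (ZMod 2) G = g := by
  let f : Characteristic g →ₗ[ZMod 2] Module.Dual (ZMod 2) G :=
    (LinearMap.lcomp (ZMod 2) (ZMod 2) G.subtype) ∘ₗ pairingLin
  have hker : LinearMap.ker f = G := by
    ext x
    rw [LinearMap.mem_ker]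
    constructor
    · intro h
      refine mem_of_pairing_eq_zero hG fun n hn => ?_
      exact congrArg (fun φ : Module.Dual (ZMod 2) G => φ ⟨n, hn⟩) h
    · intro hx
      ext n
      exact hG.1 x hx n n.2
  have hrange : LinearMap.range f = ⊤ := by
    rw [LinearMap.range_eq_top]
    intro ψ
    obtain ⟨φ, hφ⟩ := LinearMap.exists_extend ψ
    obtain ⟨x, hx⟩ := exists_pairing_eq φ
    refine ⟨x, ?_⟩
    ext n
    rw [← hφ]
    exact hx n
  have h := LinearMap.finrank_range_add_finrank_ker f
  rw [hker, hrange, finrank_top, Subspace.dual_finrank_eq, Module.finrank_prod,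
    Module.finrank_fin_fun] at h
  omega

theorem natCard_gopelGroup {G : Submodule (ZMod 2) (Characteristic g)}
    (hG : Maximal IsIsotropic G) : Nat.card G = 2 ^ g := by
  rw [Module.natCard_eq_pow_finrank (K := ZMod 2), finrank_gopelGroup hG, Nat.card_zmod]

theorem isEvenTranslate_evenCoset (G : GopelGroup g) : IsEvenTranslate G.1 (evenCoset G) :=
  (existsUnique_evenTranslate G.2).choose_spec.1

theorem evenCoset_eq_of_isEvenTranslate {G : GopelGroup g} {M : Set (Characteristic g)}
    (h : IsEvenTranslate G.1 M) : evenCoset G = M :=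
  (existsUnique_evenTranslate G.2).unique (isEvenTranslate_evenCoset G) h

theorem add_mem_evenCoset {G : GopelGroup g} {m x : Characteristic g} (hm : m ∈ evenCoset G)
    (hx : x ∈ G.1) : m + x ∈ evenCoset G := by
  obtain ⟨⟨c, hc⟩, -⟩ := isEvenTranslate_evenCoset G
  rw [hc] at hm ⊢
  obtain ⟨y, hy, rfl⟩ := hm
  exact ⟨y + x, G.1.add_mem hy hx, add_assoc _ _ _⟩

theorem characteristic_add_self (m : Characteristic g) : m + m = 0 := by
  ext i <;> exact zmod_add_self _

theorem add_mem_of_mem_evenCoset {G : GopelGroup g} {m n : Characteristic g}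
    (hm : m ∈ evenCoset G) (hn : n ∈ evenCoset G) : m + n ∈ G.1 := by
  obtain ⟨⟨c, hc⟩, -⟩ := isEvenTranslate_evenCoset G
  rw [hc] at hm hn
  obtain ⟨x, hx, rfl⟩ := hm
  obtain ⟨y, hy, rfl⟩ := hn
  rw [show c + x + (c + y) = (c + c) + (x + y) by abel, characteristic_add_self, zero_add]
  exact G.1.add_mem hx hy

theorem evenCoset_nonempty (G : GopelGroup g) : (evenCoset G).Nonempty := by
  obtain ⟨⟨c, hc⟩, -⟩ := isEvenTranslate_evenCoset G
  rw [hc]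
  exact ⟨c, 0, G.1.zero_mem, by simp⟩

open Classical in
theorem card_evenCoset (G : GopelGroup g) :
    (Finset.univ.filter fun m => m ∈ evenCoset G).card = 2 ^ g := by
  obtain ⟨c, hc⟩ := evenCoset_nonempty G
  rw [← natCard_gopelGroup G.2, Nat.card_eq_fintype_card, Fintype.card_subtype]
  refine Finset.card_bij' (fun m _ => c + m) (fun m _ => c + m) ?_ ?_ ?_ ?_
  · intro m hm
    simpa using add_mem_of_mem_evenCoset hc (by simpa using hm)
  · intro m hm
    simpa using add_mem_evenCoset hc (by simpa using hm)
  · intro m _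
    rw [← add_assoc, characteristic_add_self, zero_add]
  · intro m _
    rw [← add_assoc, characteristic_add_self, zero_add]

/-- This divisibility accounts for the values `4`, `2`, `1` of the exponent. -/
theorem four_dvd_gopelExponent_mul (hg : 1 ≤ g) : 4 ∣ gopelExponent g * 2 ^ (g - 1) := by
  unfold gopelExponent
  split_ifs with h1 h2
  · exact Dvd.intro _ rfl
  · subst h2; norm_num
  · obtain ⟨n, rfl⟩ : ∃ n, g = n + 3 := ⟨g - 3, by omega⟩
    rw [one_mul, show n + 3 - 1 = n + 2 by omega, pow_add]
    exact Dvd.intro_left _ rfl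

open Classical in
-- If `ℓ` is nonzero on `G`, translation by some `x ∈ G` with `ℓ x = 1` exchanges the two halves of
-- the coset; otherwise `ℓ` is constant on the coset. The count is thus `2 ^ (g - 1)`, `2 ^ g` or
-- `0`.
theorem four_dvd_card_filter (hg : 1 ≤ g) (G : GopelGroup g)
    (ℓ : Characteristic g →ₗ[ZMod 2] ZMod 2) :
    4 ∣ gopelExponent g * (Finset.univ.filter fun m => m ∈ evenCoset G ∧ ℓ m = 1).card := by
  have h4 := four_dvd_gopelExponent_mul hg
  have htot : (Finset.univ.filter fun m => m ∈ evenCoset G ∧ ℓ m = 1).card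
      + (Finset.univ.filter fun m => m ∈ evenCoset G ∧ ¬ ℓ m = 1).card = 2 ^ g := by
    rw [← card_evenCoset G, ← Finset.filter_filter, ← Finset.filter_filter]
    exact Finset.card_filter_add_card_filter_not _
  have hz : ∀ t : ZMod 2, ¬ t = 1 ↔ t = 0 := by decide
  have hpow : 2 ^ g = 2 * 2 ^ (g - 1) := by
    rw [← pow_succ']; congr 1; omega
  by_cases hx : ∃ x ∈ G.1, ℓ x = 1
  · obtain ⟨x, hxG, hx⟩ := hx
    have heq : (Finset.univ.filter fun m => m ∈ evenCoset G ∧ ℓ m = 1).card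
        = (Finset.univ.filter fun m => m ∈ evenCoset G ∧ ¬ ℓ m = 1).card := by
      refine Finset.card_bij' (fun m _ => m + x) (fun m _ => m + x) ?_ ?_ ?_ ?_
      · intro m hm
        simp only [Finset.mem_filter, Finset.mem_univ, true_and] at hm ⊢
        refine ⟨add_mem_evenCoset hm.1 hxG, ?_⟩
        rw [map_add, hm.2, hx]; decide
      · intro m hm
        simp only [Finset.mem_filter, Finset.mem_univ, true_and, hz] at hm ⊢
        refine ⟨add_mem_evenCoset hm.1 hxG, ?_⟩
        rw [map_add, hm.2, hx]; decide
      · intro m _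
        rw [add_assoc, characteristic_add_self, add_zero]
      · intro m _
        rw [add_assoc, characteristic_add_self, add_zero]
    have : (Finset.univ.filter fun m => m ∈ evenCoset G ∧ ℓ m = 1).card = 2 ^ (g - 1) := by
      omega
    rwa [this]
  · push Not at hx
    obtain ⟨c, hc⟩ := evenCoset_nonempty G
    have hconst : ∀ m ∈ evenCoset G, ℓ m = ℓ c := by
      intro m hm
      have h1 := hx _ (add_mem_of_mem_evenCoset hm hc)
      replace h1 := (hz _).1 h1
      rw [map_add] at h1
      rw [eq_neg_of_add_eq_zero_left h1, ZMod.neg_eq_self_mod_two]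
    by_cases hc1 : ℓ c = 1
    · have : (Finset.univ.filter fun m => m ∈ evenCoset G ∧ ¬ ℓ m = 1).card = 0 := by
        rw [Finset.card_eq_zero, Finset.filter_eq_empty_iff]
        rintro m - ⟨hm, hm1⟩
        exact hm1 ((hconst m hm).trans hc1)
      rw [this, add_zero] at htot
      rw [htot, hpow, mul_left_comm]
      exact Dvd.dvd.mul_left h4 _
    · have : (Finset.univ.filter fun m => m ∈ evenCoset G ∧ ℓ m = 1).card = 0 := by
        rw [Finset.card_eq_zero, Finset.filter_eq_empty_iff]
        rintro m - ⟨hm, hm1⟩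
        exact hc1 ((hconst m hm).symm.trans hm1)
      rw [this, mul_zero]
      exact dvd_zero _

/-- The affine map `φ` with linear part `L` preserves the pairing and the parity. -/
structure IsParityAffine (L : Characteristic g ≃ₗ[ZMod 2] Characteristic g)
    (φ : Characteristic g → Characteristic g) : Prop where
  pairing : ∀ m n, pairing (L m) (L n) = pairing m n
  map_add : ∀ m x, φ (m + x) = φ m + L x
  even : ∀ m, IsEven m → IsEven (φ m)

theorem IsParityAffine.injective {L : Characteristic g ≃ₗ[ZMod 2] Characteristic g}
    {φ : Characteristic g → Characteristic g} (h : IsParityAffine L φ) :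
    Function.Injective φ := by
  intro m n hmn
  have e := h.map_add m (m + n)
  rw [← add_assoc, characteristic_add_self, zero_add, ← hmn, left_eq_add] at e
  have e' : m + n = 0 := L.injective (by rw [e, _root_.map_zero])
  calc m = m + n + n := by rw [add_assoc, characteristic_add_self, add_zero]
    _ = n := by rw [e', zero_add]

theorem maximal_isIsotropic_map {L : Characteristic g ≃ₗ[ZMod 2] Characteristic g}
    (hL : ∀ m n, pairing (L m) (L n) = pairing m n) {G : Submodule (ZMod 2) (Characteristic g)}
    (hG : Maximal IsIsotropic G) : Maximal IsIsotropic (G.map L.toLinearMap) := by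
  rw [maximal_isIsotropic_iff] at hG ⊢
  constructor
  · rintro _ ⟨m, hm, rfl⟩ _ ⟨n, hn, rfl⟩
    exact (hL m n).trans (hG.1 m hm n hn)
  · intro x hx
    refine ⟨L.symm x, hG.2 _ fun n hn => ?_, L.apply_symm_apply x⟩
    rw [← hL, L.apply_symm_apply]
    exact hx _ ⟨n, hn, rfl⟩

/-- The permutation of the Göpel groups induced by a symplectic map. -/
def gopelPerm (L : Characteristic g ≃ₗ[ZMod 2] Characteristic g)
    (hL : ∀ m n, pairing (L m) (L n) = pairing m n) : Equiv.Perm (GopelGroup g) where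
  toFun G := ⟨G.1.map L.toLinearMap, maximal_isIsotropic_map hL G.2⟩
  invFun G := ⟨G.1.map L.symm.toLinearMap, maximal_isIsotropic_map
    (fun m n => by rw [← hL, L.apply_symm_apply, L.apply_symm_apply]) G.2⟩
  left_inv G := Subtype.ext (by
    ext x
    simp)
  right_inv G := Subtype.ext (by
    ext x
    simp)

/-- The image of the even coset is a translate of the image group consisting of even
characteristics, so uniqueness identifies it. -/
theorem evenCoset_gopelPerm {L : Characteristic g ≃ₗ[ZMod 2] Characteristic g}
    {φ : Characteristic g → Characteristic g} (h : IsParityAffine L φ) (G : GopelGroup g) :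
    evenCoset (gopelPerm L h.pairing G) = φ '' evenCoset G := by
  apply evenCoset_eq_of_isEvenTranslate
  obtain ⟨⟨c, hc⟩, he⟩ := isEvenTranslate_evenCoset G
  constructor
  · refine ⟨φ c, ?_⟩
    rw [hc]
    ext m
    constructor
    · rintro ⟨_, ⟨x, hx, rfl⟩, rfl⟩
      exact ⟨L x, ⟨x, hx, rfl⟩, h.map_add c x⟩
    · rintro ⟨_, ⟨x, hx, rfl⟩, rfl⟩
      exact ⟨c + x, ⟨x, hx, rfl⟩, h.map_add c x⟩
  · rintro _ ⟨m, hm, rfl⟩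
    exact h.even m (he m hm)

instance : Finite (GopelGroup g) :=
  Finite.of_injective (fun G : GopelGroup g => (G.1 : Set (Characteristic g)))
    fun _ _ h => Subtype.ext (SetLike.coe_injective h)

/-- The linear part of the action of a translation on characteristics. -/
def shearEquiv (S : Matrix (Fin g) (Fin g) (ZMod 2)) :
    Characteristic g ≃ₗ[ZMod 2] Characteristic g where
  toFun m := (m.1, m.2 + S *ᵥ m.1)
  invFun m := (m.1, m.2 + S *ᵥ m.1)
  map_add' m n := by
    ext i <;> simp [Matrix.mulVec_add]; ring
  map_smul' c m := by
    ext i <;> simp [Matrix.mulVec_smul]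
  left_inv m := by
    ext i
    · rfl
    · simp [add_assoc, zmod_add_self]
  right_inv m := by
    ext i
    · rfl
    · simp [add_assoc, zmod_add_self]

/-- Off-diagonal terms cancel in pairs by symmetry, and `t * t = t` on the diagonal. The form is
therefore linear, and the affine term `S.diag` of the action on characteristics compensates it. -/
theorem dotProduct_mulVec_self {S : Matrix (Fin g) (Fin g) (ZMod 2)} (hS : Sᵀ = S)
    (a : Fin g → ZMod 2) : a ⬝ᵥ (S *ᵥ a) = a ⬝ᵥ S.diag := by
  have hs : ∀ i j, S i j = S j i := fun i j => congrFun (congrFun hS j) i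
  have h2 : ∀ t : ZMod 2, t * t = t := by decide
  simp only [dotProduct, mulVec, Finset.mul_sum, Matrix.diag]
  rw [← Finset.sum_product']
  rw [← Finset.sum_filter_add_sum_filter_not _ (fun p : Fin g × Fin g => p.1 = p.2)]
  have e1 : ∑ p ∈ (Finset.univ ×ˢ Finset.univ).filter (fun p : Fin g × Fin g => ¬ p.1 = p.2),
      a p.1 * (S p.1 p.2 * a p.2) = 0 := by
    refine Finset.sum_involution (fun p _ => (p.2, p.1)) ?_ ?_ ?_ ?_
    · rintro ⟨i, j⟩ _
      change a i * (S i j * a j) + a j * (S j i * a i) = 0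
      rw [hs j i, show a j * (S i j * a i) = a i * (S i j * a j) by ring, zmod_add_self]
    · rintro ⟨i, j⟩ hp _ h
      simp only [Finset.mem_filter] at hp
      exact hp.2 (Prod.ext_iff.1 h).2
    · rintro ⟨i, j⟩ hp
      simp only [Finset.mem_filter] at hp ⊢
      exact ⟨by simp, fun h => hp.2 h.symm⟩
    · rintro ⟨i, j⟩ _
      rfl
  rw [e1, add_zero]
  symm
  refine Finset.sum_bij (fun i _ => (i, i)) (by simp) (by simp) ?_ ?_
  · rintro ⟨i, j⟩ hp
    simp only [Finset.mem_filter] at hp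
    exact ⟨i, Finset.mem_univ _, Prod.ext rfl hp.2⟩
  · intro i _
    rw [mul_left_comm, h2, mul_comm]

theorem isParityAffine_shear {S : Matrix (Fin g) (Fin g) (ZMod 2)} (hS : Sᵀ = S) :
    IsParityAffine (shearEquiv S) (fun m => (m.1, m.2 + S *ᵥ m.1 + S.diag)) where
  pairing m n := by
    have h : m.1 ⬝ᵥ (S *ᵥ n.1) = (S *ᵥ m.1) ⬝ᵥ n.1 := by
      rw [Matrix.dotProduct_mulVec, ← Matrix.mulVec_transpose, hS]
    simp only [SiegelTheta.pairing, shearEquiv, LinearEquiv.coe_mk, LinearMap.coe_mk,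
      AddHom.coe_mk, dotProduct_add, add_dotProduct, h]
    linear_combination zmod_add_self ((S *ᵥ m.1) ⬝ᵥ n.1)
  map_add m x := by
    ext i
    · rfl
    · simp [shearEquiv, Matrix.mulVec_add]; ring
  even m hm := by
    rw [IsEven] at hm ⊢
    simp only [dotProduct_add, hm, dotProduct_mulVec_self hS]
    rw [zero_add, zmod_add_self]

/-- Exchange of the `i`-th entries of the two rows of a characteristic. -/
def swapAt (i : Fin g) : Characteristic g ≃ₗ[ZMod 2] Characteristic g where
  toFun m := (Function.update m.1 i (m.2 i), Function.update m.2 i (m.1 i))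
  invFun m := (Function.update m.1 i (m.2 i), Function.update m.2 i (m.1 i))
  map_add' m n := by
    ext j <;> by_cases h : j = i <;> simp [h]
  map_smul' c m := by
    ext j <;> by_cases h : j = i <;> simp [h]
  left_inv m := by
    ext j <;> by_cases h : j = i <;> simp [h]
  right_inv m := by
    ext j <;> by_cases h : j = i <;> simp [h]

theorem isParityAffine_swapAt (i : Fin g) : IsParityAffine (swapAt i) (swapAt i) where
  pairing m n := by
    simp only [SiegelTheta.pairing, swapAt, LinearEquiv.coe_mk, LinearMap.coe_mk,
      AddHom.coe_mk, dotProduct, ← Finset.sum_add_distrib]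
    refine Finset.sum_congr rfl fun j _ => ?_
    by_cases h : j = i
    · subst h; simp [add_comm]
    · simp [h]
  map_add m x := map_add _ _ _
  even m hm := by
    rw [IsEven] at hm ⊢
    rw [← hm]
    simp only [swapAt, LinearEquiv.coe_mk, LinearMap.coe_mk, AddHom.coe_mk, dotProduct]
    refine Finset.sum_congr rfl fun j _ => ?_
    by_cases h : j = i
    · subst h; simp [mul_comm]
    · simp [h]

end Combinatorics
-- Gaussian majorants.
section Summability

theorem summable_pi_prod {g : ℕ} {f : Fin g → ℤ → ℝ} (h0 : ∀ i n, 0 ≤ f i n)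
    (hf : ∀ i, Summable (f i)) : Summable fun n : Fin g → ℤ => ∏ i, f i (n i) := by
  induction g with
  | zero => exact (hasSum_fintype _).summable
  | succ g ih =>
    rw [← (Fin.consEquiv fun _ : Fin (g + 1) => ℤ).summable_iff]
    have h := (hf 0).mul_of_nonneg (ih (f := fun i => f i.succ) (fun i => h0 i.succ)
      fun i => hf i.succ) (h0 0) fun n => Finset.prod_nonneg fun i _ => h0 _ _
    refine h.congr fun p => ?_
    simp [Fin.consEquiv, Fin.prod_univ_succ]

theorem summable_exp_neg_sq {c : ℝ} (hc : 0 < c) (α : ℝ) :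
    Summable fun n : ℤ => Real.exp (-c * (n + α) ^ 2) := by
  have hτ : 0 < ((c / Real.pi : ℝ) * Complex.I).im := by
    simpa using div_pos hc Real.pi_pos
  -- Completing the square: the Gaussian is `exp (-c α ^ 2)` times the norm of a Jacobi theta term
  -- with `z = c α i / π` and `τ = c i / π`.
  have h := ((summable_jacobiTheta₂_term_iff ((c * α / Real.pi : ℝ) * Complex.I)
    ((c / Real.pi : ℝ) * Complex.I)).2 hτ).norm.mul_left (Real.exp (-c * α ^ 2))
  refine h.congr fun n => ?_
  rw [norm_jacobiTheta₂_term, ← Real.exp_add]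
  congr 1
  simp only [Complex.im_ofReal_mul, Complex.I_im, mul_one]
  field_simp
  ring

theorem summable_gaussian {g : ℕ} {c : ℝ} (hc : 0 < c) (α : Fin g → ℝ) :
    Summable fun n : Fin g → ℤ => Real.exp (-c * ∑ i, ((n i : ℝ) + α i) ^ 2) := by
  refine (summable_pi_prod (f := fun i n => Real.exp (-c * (n + α i) ^ 2))
    (fun _ _ => (Real.exp_pos _).le) fun i => summable_exp_neg_sq hc (α i)).congr fun n => ?_
  rw [← Real.exp_sum, Finset.mul_sum]

/-- The form has a positive minimum on the unit sphere of the supremum norm; homogeneity and `∑ x i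
^ 2 ≤ g ‖x‖ ^ 2` do the rest. If the sphere is empty, the zero vector is the only one. -/
theorem exists_pos_mul_le_of_posDef {g : ℕ} {Y : Matrix (Fin g) (Fin g) ℝ} (hY : Y.PosDef) :
    ∃ c, 0 < c ∧ ∀ x : Fin g → ℝ, c * ∑ i, x i ^ 2 ≤ x ⬝ᵥ (Y *ᵥ x) := by
  by_cases hne : (Metric.sphere (0 : Fin g → ℝ) 1).Nonempty
  · have hcont : Continuous fun x : Fin g → ℝ => x ⬝ᵥ (Y *ᵥ x) := by
      unfold Matrix.mulVec dotProduct
      fun_prop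
    obtain ⟨x₀, hx₀, hmin⟩ := (isCompact_sphere (0 : Fin g → ℝ) 1).exists_isMinOn hne
      hcont.continuousOn
    have hx₀' : x₀ ≠ 0 := by
      rintro rfl
      simp at hx₀
    have hpos : 0 < x₀ ⬝ᵥ (Y *ᵥ x₀) := by simpa using hY.dotProduct_mulVec_pos hx₀'
    have hg : (0 : ℝ) < g := by
      rcases Nat.eq_zero_or_pos g with rfl | hg
      · exact absurd (Subsingleton.elim x₀ 0) hx₀'
      · exact_mod_cast hg
    refine ⟨x₀ ⬝ᵥ (Y *ᵥ x₀) / g, div_pos hpos hg, fun x => ?_⟩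
    have hsum : ∑ i, x i ^ 2 ≤ g * ‖x‖ ^ 2 := by
      calc ∑ i, x i ^ 2 ≤ ∑ _i : Fin g, ‖x‖ ^ 2 := Finset.sum_le_sum fun i _ => by
            rw [← sq_abs]
            exact pow_le_pow_left₀ (abs_nonneg _) (norm_le_pi_norm x i) 2
        _ = g * ‖x‖ ^ 2 := by simp
    have h1 : x₀ ⬝ᵥ (Y *ᵥ x₀) / g * ∑ i, x i ^ 2 ≤ x₀ ⬝ᵥ (Y *ᵥ x₀) * ‖x‖ ^ 2 := by
      calc _ ≤ x₀ ⬝ᵥ (Y *ᵥ x₀) / g * (g * ‖x‖ ^ 2) :=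
            mul_le_mul_of_nonneg_left hsum (div_pos hpos hg).le
        _ = _ := by field_simp
    refine h1.trans ?_
    by_cases hx : x = 0
    · subst hx; simp
    · have hn : ‖x‖ ≠ 0 := norm_ne_zero_iff.2 hx
      have h2 := hmin (show ‖x‖⁻¹ • x ∈ Metric.sphere (0 : Fin g → ℝ) 1 by
        simp [norm_smul, hn])
      simp only [Set.mem_ofPred_eq, Matrix.mulVec_smul, smul_dotProduct, dotProduct_smul,
        smul_eq_mul] at h2
      calc _ ≤ (‖x‖⁻¹ * (‖x‖⁻¹ * (x ⬝ᵥ (Y *ᵥ x)))) * ‖x‖ ^ 2 :=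
            mul_le_mul_of_nonneg_right h2 (sq_nonneg _)
        _ = _ := by field_simp
  · refine ⟨1, one_pos, fun x => ?_⟩
    have hx : x = 0 := by
      by_contra hx
      exact hne ⟨‖x‖⁻¹ • x, by simp [norm_smul, norm_ne_zero_iff.2 hx]⟩
    subst hx; simp

end Summability

/-! ### Theta series: convergence and limits along the imaginary axis. -/

section Theta

variable {g : ℕ}

/-- The vector `n + a / 2`. -/
noncomputable def thetaVec (m : Characteristic g) (n : Fin g → ℤ) : Fin g → ℝ :=
  fun i => n i + (lift (m.1 i) : ℝ) / 2

/-- The exponent of a term of a theta series, divided by `π i`. -/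
noncomputable def thetaExponent (m : Characteristic g) (n : Fin g → ℤ)
    (Z : Matrix (Fin g) (Fin g) ℂ) : ℂ :=
  (fun i => (thetaVec m n i : ℂ)) ⬝ᵥ (Z *ᵥ fun i => (thetaVec m n i : ℂ))
    + (fun i => (lift (m.2 i) : ℂ)) ⬝ᵥ fun i => (thetaVec m n i : ℂ)

/-- A term of a theta series. -/
noncomputable def thetaTerm (m : Characteristic g) (n : Fin g → ℤ)
    (Z : Matrix (Fin g) (Fin g) ℂ) : ℂ :=
  Complex.exp (Real.pi * Complex.I * thetaExponent m n Z)

theorem thetaConstant_eq_tsum (m : Characteristic g) (Z : siegelHalfSpace g) :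
    thetaConstant m Z = ∑' n, thetaTerm m n Z.1 := by
  simp [thetaConstant, thetaTerm, thetaExponent, thetaVec]

theorem im_form (x : Fin g → ℝ) (Z : Matrix (Fin g) (Fin g) ℂ) :
    ((fun i => (x i : ℂ)) ⬝ᵥ (Z *ᵥ fun i => (x i : ℂ))).im = x ⬝ᵥ (Z.map Complex.im *ᵥ x) := by
  simp [dotProduct, Matrix.mulVec, Finset.mul_sum, Complex.im_sum]

theorem norm_thetaTerm (m : Characteristic g) (n : Fin g → ℤ) (Z : Matrix (Fin g) (Fin g) ℂ) :
    ‖thetaTerm m n Z‖ =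
      Real.exp (-Real.pi * (thetaVec m n ⬝ᵥ (Z.map Complex.im *ᵥ thetaVec m n))) := by
  have h : (thetaExponent m n Z).im = thetaVec m n ⬝ᵥ (Z.map Complex.im *ᵥ thetaVec m n) := by
    rw [thetaExponent, Complex.add_im, im_form]
    simp [dotProduct, Complex.im_sum]
  rw [thetaTerm, Complex.norm_exp, ← h]
  simp

theorem norm_thetaTerm_le {m : Characteristic g} {Z : Matrix (Fin g) (Fin g) ℂ} {c : ℝ}
    (hc : ∀ x : Fin g → ℝ, c * ∑ i, x i ^ 2 ≤ x ⬝ᵥ (Z.map Complex.im *ᵥ x)) (n : Fin g → ℤ) :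
    ‖thetaTerm m n Z‖ ≤ Real.exp (-(Real.pi * c) * ∑ i, thetaVec m n i ^ 2) := by
  rw [norm_thetaTerm, Real.exp_le_exp]
  have := mul_le_mul_of_nonneg_left (hc (thetaVec m n)) Real.pi_pos.le
  linarith

theorem summable_thetaTerm (m : Characteristic g) (Z : siegelHalfSpace g) :
    Summable fun n => thetaTerm m n Z.1 := by
  obtain ⟨c, hc, h⟩ := exists_pos_mul_le_of_posDef Z.2.2
  exact Summable.of_norm_bounded (summable_gaussian (mul_pos Real.pi_pos hc) _)
    fun n => norm_thetaTerm_le h n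

/-- For `Im Z ≥ 1` one Gaussian series dominates all theta series. This supplies boundedness at the
cusps. -/
theorem norm_thetaConstant_le (m : Characteristic g) : ∃ K : ℝ, ∀ Z : siegelHalfSpace g,
    (Z.1.map Complex.im - (1 : ℝ) • (1 : Matrix (Fin g) (Fin g) ℝ)).PosSemidef →
      ‖thetaConstant m Z‖ ≤ K := by
  refine ⟨∑' n, Real.exp (-(Real.pi * 1) * ∑ i, thetaVec m n i ^ 2), fun Z hZ => ?_⟩
  rw [thetaConstant_eq_tsum]
  refine tsum_of_norm_bounded (summable_gaussian (by positivity) _).hasSum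
    fun n => norm_thetaTerm_le (fun x => ?_) n
  have h := hZ.dotProduct_mulVec_nonneg x
  simp only [star_trivial, one_smul, Matrix.sub_mulVec, Matrix.one_mulVec, dotProduct_sub] at h
  have e : x ⬝ᵥ x = ∑ i, x i ^ 2 := Finset.sum_congr rfl fun i _ => (sq _).symm
  linarith

/-- The points `(N + 1) i` of the half space. -/
noncomputable def cuspPoint (g N : ℕ) : siegelHalfSpace g :=
  ⟨((N + 1 : ℝ) * Complex.I) • (1 : Matrix (Fin g) (Fin g) ℂ), by
    constructor
    · simp
    · have : ((((N + 1 : ℝ) : ℂ) * Complex.I) • (1 : Matrix (Fin g) (Fin g) ℂ)).map Complex.im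
          = (N + 1 : ℝ) • (1 : Matrix (Fin g) (Fin g) ℝ) := by
        ext i j
        by_cases h : i = j
        · subst h; simp
        · simp [h]
      rw [this]
      exact Matrix.PosDef.one.smul (by positivity)⟩

theorem im_cuspPoint_form (N : ℕ) (x : Fin g → ℝ) :
    x ⬝ᵥ ((cuspPoint g N).1.map Complex.im *ᵥ x) = (N + 1) * ∑ i, x i ^ 2 := by
  have : (cuspPoint g N).1.map Complex.im = (N + 1 : ℝ) • (1 : Matrix (Fin g) (Fin g) ℝ) := by
    ext i j
    by_cases h : i = j
    · subst h; simp [cuspPoint]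
    · simp [cuspPoint, h]
  rw [this, Matrix.smul_mulVec, Matrix.one_mulVec, dotProduct_smul, smul_eq_mul]
  congr 1
  exact Finset.sum_congr rfl fun i _ => (sq _).symm

theorem thetaVec_eq_zero_iff {m : Characteristic g} {n : Fin g → ℤ} :
    thetaVec m n = 0 ↔ m.1 = 0 ∧ n = 0 := by
  constructor
  · intro h
    have key : ∀ i, m.1 i = 0 ∧ n i = 0 := fun i => by
      have hi := congrFun h i
      simp only [thetaVec, Pi.zero_apply] at hi
      have hi' : 2 * n i + lift (m.1 i) = 0 := by
        have : (2 * n i + lift (m.1 i) : ℝ) = 0 := by linarith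
        exact_mod_cast this
      have hl : ∀ t : ZMod 2, (t = 0 ∧ lift t = 0) ∨ lift t = 1 := by decide
      rcases hl (m.1 i) with h | h
      · exact ⟨h.1, by omega⟩
      · omega
    exact ⟨funext fun i => (key i).1, funext fun i => (key i).2⟩
  · rintro ⟨h1, h2⟩
    funext i
    simp [thetaVec, h1, h2, lift]

open Classical in
-- Only a term with `n + a / 2 = 0` survives, which requires `a = 0` and `n = 0`. The interchange of
-- limit and sum is dominated by the Gaussian for imaginary part `1`.
theorem tendsto_thetaConstant_cuspPoint (m : Characteristic g) :
    Filter.Tendsto (fun N => thetaConstant m (cuspPoint g N)) Filter.atTop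
      (nhds (if m.1 = 0 then 1 else 0)) := by
  have hlim : ∑' n, (if thetaVec m n = 0 then (1 : ℂ) else 0) = if m.1 = 0 then 1 else 0 := by
    rw [tsum_eq_single 0]
    · simp [thetaVec_eq_zero_iff]
    · intro n hn
      simp [thetaVec_eq_zero_iff, hn]
  rw [← hlim]
  simp only [thetaConstant_eq_tsum]
  refine tendsto_tsum_of_dominated_convergence
    (bound := fun n => Real.exp (-(Real.pi * 1) * ∑ i, thetaVec m n i ^ 2))
    (summable_gaussian (by positivity) _) (fun n => ?_) (Filter.Eventually.of_forall fun N n => ?_)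
  · split_ifs with h
    · refine tendsto_const_nhds.congr fun N => ?_
      simp [thetaTerm, thetaExponent, h]
    · rw [tendsto_zero_iff_norm_tendsto_zero]
      simp only [norm_thetaTerm, im_cuspPoint_form]
      have hpos : 0 < ∑ i, thetaVec m n i ^ 2 := by
        obtain ⟨i, hi⟩ := Function.ne_iff.1 h
        exact Finset.sum_pos' (fun i _ => sq_nonneg _) ⟨i, Finset.mem_univ _, by
          have : thetaVec m n i ≠ 0 := hi
          positivity⟩
      refine Real.tendsto_exp_atBot.comp ?_
      have h1 : Filter.Tendsto (fun N : ℕ => (Real.pi * ∑ i, thetaVec m n i ^ 2) * ((N : ℝ) + 1))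
          Filter.atTop Filter.atTop :=
        (Filter.tendsto_atTop_add_const_right _ _ tendsto_natCast_atTop_atTop).const_mul_atTop
          (mul_pos Real.pi_pos hpos)
      refine (Filter.tendsto_neg_atTop_atBot.comp h1).congr fun N => ?_
      simp only [Function.comp_apply]; ring
  · refine norm_thetaTerm_le (fun x => ?_) n
    rw [im_cuspPoint_form]
    have h : 0 ≤ ∑ i, x i ^ 2 := Finset.sum_nonneg fun i _ => sq_nonneg _
    have h' : (0 : ℝ) ≤ N := Nat.cast_nonneg N
    nlinarith

end Theta

/-! ### Holomorphy in the independent entries of `Z`. -/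

section Holomorphy

variable {g : ℕ}

/-- The linear form `w ↦ x ᵗ Z x` in the coordinates `w` of `Z`. -/
noncomputable def quadraticCoord (x : Fin g → ℝ) : (Sym2 (Fin g) → ℂ) →L[ℂ] ℂ :=
  ∑ i, ∑ j, ((x i : ℂ) * (x j : ℂ)) • ContinuousLinearMap.proj (R := ℂ) (φ := fun _ => ℂ) s(i, j)

theorem quadraticCoord_apply (x : Fin g → ℝ) (w : Sym2 (Fin g) → ℂ) :
    quadraticCoord x w =
      (fun i => (x i : ℂ)) ⬝ᵥ (symmetricOfCoords w *ᵥ fun i => (x i : ℂ)) := by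
  simp only [quadraticCoord, _root_.sum_apply, _root_.smul_apply,
    ContinuousLinearMap.proj_apply, smul_eq_mul, dotProduct, mulVec, Finset.mul_sum,
    symmetricOfCoords, Matrix.of_apply]
  exact Finset.sum_congr rfl fun i _ => Finset.sum_congr rfl fun j _ => by ring

theorem norm_quadraticCoord_le (x : Fin g → ℝ) : ‖quadraticCoord x‖ ≤ g * ∑ i, x i ^ 2 := by
  have h1 : ‖quadraticCoord x‖ ≤ (∑ i, |x i|) ^ 2 := by
    refine ContinuousLinearMap.opNorm_le_bound _ (sq_nonneg _) fun w => ?_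
    rw [quadraticCoord, _root_.sum_apply, sq, Finset.sum_mul_sum, Finset.sum_mul]
    refine norm_sum_le_of_le _ fun i _ => ?_
    rw [_root_.sum_apply, Finset.sum_mul]
    refine norm_sum_le_of_le _ fun j _ => ?_
    simp only [_root_.smul_apply, ContinuousLinearMap.proj_apply, smul_eq_mul,
      norm_mul, Complex.norm_real, Real.norm_eq_abs]
    exact mul_le_mul_of_nonneg_left (norm_le_pi_norm w _) (by positivity)
  refine h1.trans ?_
  have := sq_sum_le_card_mul_sum_sq (s := Finset.univ) (f := fun i => |x i|)
  simpa using this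

theorem differentiableAt_tsum_thetaTerm (m : Characteristic g) {w₀ : Sym2 (Fin g) → ℂ}
    (h₀ : symmetricOfCoords w₀ ∈ siegelHalfSpace g) :
    DifferentiableAt ℂ (fun w => ∑' n, thetaTerm m n (symmetricOfCoords w)) w₀ := by
  obtain ⟨c, hc, hY⟩ := exists_pos_mul_le_of_posDef h₀.2
  -- On the ball of radius `δ` the imaginary part of the form changes by at most `g δ ∑ x i ^ 2`, so
  -- the lower bound `c / 2` persists.
  obtain ⟨δ, hδ, hδc⟩ : ∃ δ > 0, δ * (g : ℝ) ≤ c / 2 := by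
    refine ⟨c / (2 * (g + 1)), by positivity, ?_⟩
    rw [div_mul_eq_mul_div, div_le_div_iff₀ (by positivity) (by positivity)]
    nlinarith
  set s : (Fin g → ℤ) → ℝ := fun n => ∑ i, thetaVec m n i ^ 2 with hs
  have hs0 : ∀ n, 0 ≤ s n := fun n => Finset.sum_nonneg fun i _ => sq_nonneg _
  have hbound : ∀ n, ∀ w ∈ Metric.ball w₀ δ,
      ‖thetaTerm m n (symmetricOfCoords w)‖ ≤ Real.exp (-(Real.pi * (c / 2)) * s n) := by
    intro n w hw
    refine norm_thetaTerm_le (fun x => ?_) n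
    have h1 := hY x
    rw [← im_form, ← quadraticCoord_apply] at h1 ⊢
    have h2 : |(quadraticCoord x (w - w₀)).im| ≤ c / 2 * ∑ i, x i ^ 2 := by
      calc _ ≤ ‖quadraticCoord x (w - w₀)‖ := Complex.abs_im_le_norm _
        _ ≤ ‖quadraticCoord x‖ * ‖w - w₀‖ := ContinuousLinearMap.le_opNorm _ _
        _ ≤ (g * ∑ i, x i ^ 2) * δ := mul_le_mul (norm_quadraticCoord_le x)
            (by rw [← dist_eq_norm]; exact (Metric.mem_ball.1 hw).le) (norm_nonneg _)
            (by positivity)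
        _ = (δ * g) * ∑ i, x i ^ 2 := by ring
        _ ≤ _ := mul_le_mul_of_nonneg_right hδc (by positivity)
    rw [map_sub, Complex.sub_im] at h2
    have := (abs_le.1 h2).1
    linarith
  have hderiv : ∀ n w, HasFDerivAt (fun w => thetaTerm m n (symmetricOfCoords w))
      (thetaTerm m n (symmetricOfCoords w) •
        ((Real.pi * Complex.I : ℂ) • quadraticCoord (thetaVec m n))) w := by
    intro n w
    have h1 : HasFDerivAt (fun w => thetaExponent m n (symmetricOfCoords w))
        (quadraticCoord (thetaVec m n)) w := by
      have := ((quadraticCoord (thetaVec m n)).hasFDerivAt (x := w)).add_const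
        ((fun i => (lift (m.2 i) : ℂ)) ⬝ᵥ fun i => (thetaVec m n i : ℂ))
      simpa only [thetaExponent, ← quadraticCoord_apply] using this
    exact (h1.const_mul (Real.pi * Complex.I : ℂ)).cexp
  -- Differentiation brings down a factor of size at most `π g s(n)`. Half of the decay, `c / 4` out
  -- of `c / 2`, absorbs it by `t ≤ exp t`.
  refine (hasFDerivAt_tsum_of_isPreconnected
    (u := fun n => (4 * g / c) * Real.exp (-(Real.pi * (c / 4)) * s n))
    ((summable_gaussian (by positivity) _).mul_left _) Metric.isOpen_ball
    (convex_ball w₀ δ).isPreconnected (fun n w _ => hderiv n w) (fun n w hw => ?_)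
    (Metric.mem_ball_self hδ) (summable_thetaTerm m ⟨_, h₀⟩)
    (Metric.mem_ball_self hδ)).differentiableAt
  rw [norm_smul, norm_smul]
  have e1 : ‖(Real.pi * Complex.I : ℂ)‖ = Real.pi := by simp [abs_of_pos Real.pi_pos]
  rw [e1]
  have h1 := hbound n w hw
  have h2 := norm_quadraticCoord_le (thetaVec m n)
  have h3 : Real.pi * (c / 4) * s n ≤ Real.exp (Real.pi * (c / 4) * s n) :=
    (by linarith : _ ≤ Real.pi * (c / 4) * s n + 1).trans (Real.add_one_le_exp _)
  calc _ ≤ Real.exp (-(Real.pi * (c / 2)) * s n) * (Real.pi * (g * s n)) :=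
        mul_le_mul h1 (mul_le_mul_of_nonneg_left h2 Real.pi_pos.le) (by positivity)
          (Real.exp_pos _).le
    _ = (4 * g / c) * (Real.exp (-(Real.pi * (c / 2)) * s n) * (Real.pi * (c / 4) * s n)) := by
        field_simp
    _ ≤ (4 * g / c) * (Real.exp (-(Real.pi * (c / 2)) * s n)
          * Real.exp (Real.pi * (c / 4) * s n)) := by gcongr
    _ = _ := by
        rw [← Real.exp_add]
        congr 2
        ring

theorem isHolomorphic_thetaGopel_pow (G : GopelGroup g) (k : ℕ) :
    IsHolomorphic fun Z => thetaGopel G Z ^ k := by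
  classical
  have h : DifferentiableOn ℂ (fun w : Sym2 (Fin g) → ℂ =>
      (∏ m : Characteristic g with m ∈ evenCoset G,
        ∑' n, thetaTerm m n (symmetricOfCoords w)) ^ k)
      {w | symmetricOfCoords w ∈ siegelHalfSpace g} := by
    intro w hw
    refine DifferentiableAt.differentiableWithinAt ?_
    exact (HasFDerivAt.finsetProd fun m _ =>
      (differentiableAt_tsum_thetaTerm m hw).hasFDerivAt).differentiableAt.fun_pow k
  refine h.congr fun w hw => ?_
  rw [Set.mem_ofPred_eq] at hw
  simp only [dif_pos hw, thetaGopel, thetaConstant_eq_tsum]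

end Holomorphy
-- Theta constants under translations.
section TranslationFormula

variable {g : ℕ}

theorem lift_cast (t : ZMod 2) : ((lift t : ℤ) : ZMod 2) = t := by
  revert t; decide

theorem exp_pi_mul_add_even (x : ℂ) (t : ℤ) :
    Complex.exp (Real.pi * Complex.I * (x + 2 * t)) = Complex.exp (Real.pi * Complex.I * x) := by
  rw [mul_add, Complex.exp_add, show (Real.pi * Complex.I * (2 * t) : ℂ) =
    t * (2 * Real.pi * Complex.I) by ring, Complex.exp_int_mul_two_pi_mul_I, mul_one]

theorem thetaExponent_add (m : Characteristic g) (n : Fin g → ℤ)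
    (Z S : Matrix (Fin g) (Fin g) ℂ) :
    thetaExponent m n (Z + S) = thetaExponent m n Z +
      (fun i => (thetaVec m n i : ℂ)) ⬝ᵥ (S *ᵥ fun i => (thetaVec m n i : ℂ)) := by
  simp only [thetaExponent, Matrix.add_mulVec, dotProduct_add]
  ring

theorem form_add_half {S : Matrix (Fin g) (Fin g) ℤ} (hS : Sᵀ = S) (n a : Fin g → ℤ) :
    (fun i => (n i : ℂ) + (a i : ℂ) / 2) ⬝ᵥ
        (S.map (Int.cast : ℤ → ℂ) *ᵥ fun i => (n i : ℂ) + (a i : ℂ) / 2) =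
      ((n ⬝ᵥ (S *ᵥ n) + n ⬝ᵥ (S *ᵥ a) : ℤ) : ℂ) + ((a ⬝ᵥ (S *ᵥ a) : ℤ) : ℂ) / 4 := by
  have hs : ∀ i j, S i j = S j i := fun i j => congrFun (congrFun hS j) i
  have e : n ⬝ᵥ (S *ᵥ a) = a ⬝ᵥ (S *ᵥ n) := by
    rw [Matrix.dotProduct_mulVec, ← Matrix.mulVec_transpose, hS, dotProduct_comm]
  have e2 : (2 : ℂ) * ((n ⬝ᵥ (S *ᵥ a) : ℤ) : ℂ) =
      ((n ⬝ᵥ (S *ᵥ a) : ℤ) : ℂ) + ((a ⬝ᵥ (S *ᵥ n) : ℤ) : ℂ) := by rw [← e]; ring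
  -- Writing the cross term as the average of its two transposes makes both double sums agree term
  -- by term.
  have e3 : ((n ⬝ᵥ (S *ᵥ a) : ℤ) : ℂ) =
      (((n ⬝ᵥ (S *ᵥ a) : ℤ) : ℂ) + ((a ⬝ᵥ (S *ᵥ n) : ℤ) : ℂ)) / 2 := by rw [← e2]; ring
  rw [Int.cast_add, e3]
  simp only [dotProduct, mulVec, Matrix.map_apply, Int.cast_sum, Int.cast_mul, Finset.mul_sum,
    ← Finset.sum_add_distrib, Finset.sum_div]
  exact Finset.sum_congr rfl fun i _ => Finset.sum_congr rfl fun j _ => by ring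

theorem thetaVec_cast (m : Characteristic g) (n : Fin g → ℤ) :
    (fun i => (thetaVec m n i : ℂ)) =
      fun i => (n i : ℂ) + ((fun i => lift (m.1 i)) i : ℂ) / 2 := by
  funext i
  simp [thetaVec]

/-- The action of a translation on characteristics. -/
def translateChar (S : Matrix (Fin g) (Fin g) ℤ) (m : Characteristic g) : Characteristic g :=
  (m.1, m.2 + S.map (Int.cast : ℤ → ZMod 2) *ᵥ m.1 + (S.map (Int.cast : ℤ → ZMod 2)).diag)

/-- Modulo two, `S[n]` is the linear form `nᵗ diag S`, so together with the cross term `nᵗ S a` it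
changes `b` to `b + S a + diag S`. What does not depend on `n` goes into the constant. -/
theorem thetaConstant_translation (S : Matrix (Fin g) (Fin g) ℤ) (hS : Sᵀ = S)
    (m : Characteristic g) : ∃ c : ℂ, c ≠ 0 ∧ ∀ Z : siegelHalfSpace g,
      thetaConstant m (moebius (translation S hS) Z) = c * thetaConstant (translateChar S m) Z := by
  obtain ⟨a, ha⟩ : ∃ a : Fin g → ℤ, a = fun i => lift (m.1 i) := ⟨_, rfl⟩
  obtain ⟨b, hb⟩ : ∃ b : Fin g → ℤ, b = fun i => lift (m.2 i) := ⟨_, rfl⟩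
  obtain ⟨b', hb'⟩ : ∃ b' : Fin g → ℤ, b' = fun i => lift ((translateChar S m).2 i) := ⟨_, rfl⟩
  have hcast : ∀ (x : Fin g → ℤ) i, (((S *ᵥ x) i : ℤ) : ZMod 2) =
      (S.map (Int.cast : ℤ → ZMod 2) *ᵥ fun j => (x j : ZMod 2)) i := by
    intro x i
    simp [mulVec, dotProduct]
  -- `2 γ` is the error made by replacing the new row by its representatives `0`, `1`; it changes
  -- the exponent by an even integer at `n` and by a constant at `a / 2`.
  have hγ : ∀ i, ∃ γ : ℤ, b i + (S *ᵥ a) i + S i i - b' i = 2 * γ := by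
    intro i
    have : (2 : ℤ) ∣ b i + (S *ᵥ a) i + S i i - b' i := by
      have h := (ZMod.intCast_zmod_eq_zero_iff_dvd (b i + (S *ᵥ a) i + S i i - b' i) 2).1
      refine h ?_
      push_cast
      rw [hcast, ha, hb, hb']
      simp [lift_cast, translateChar]
    exact this
  choose γ hγ using hγ
  have heven : ∀ n : Fin g → ℤ, ∃ t : ℤ, n ⬝ᵥ (S *ᵥ n) - n ⬝ᵥ S.diag = 2 * t := by
    intro n
    have h := (ZMod.intCast_zmod_eq_zero_iff_dvd (n ⬝ᵥ (S *ᵥ n) - n ⬝ᵥ S.diag) 2).1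
    refine h ?_
    have h1 := dotProduct_mulVec_self (S := S.map (Int.cast : ℤ → ZMod 2))
      (by rw [← Matrix.transpose_map, hS]) (fun i => (n i : ZMod 2))
    rw [Int.cast_sub, sub_eq_zero]
    simpa [dotProduct, mulVec, Matrix.diag] using h1
  set κ : ℂ := ((a ⬝ᵥ (S *ᵥ a) : ℤ) : ℂ) / 4 + ((b ⬝ᵥ a - b' ⬝ᵥ a : ℤ) : ℂ) / 2 with hκ
  refine ⟨Complex.exp (Real.pi * Complex.I * κ), Complex.exp_ne_zero _, fun Z => ?_⟩
  rw [thetaConstant_eq_tsum, thetaConstant_eq_tsum, moebius_translation, ← tsum_mul_left]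
  refine tsum_congr fun n => ?_
  obtain ⟨t, ht⟩ := heven n
  have hexp : thetaExponent m n (Z.1 + S.map (Int.cast : ℤ → ℂ)) =
      κ + thetaExponent (translateChar S m) n Z.1 + 2 * ((t + n ⬝ᵥ γ : ℤ) : ℂ) := by
    have hv : thetaVec (translateChar S m) n = thetaVec m n := rfl
    have h1 : n ⬝ᵥ (S *ᵥ n) + n ⬝ᵥ (S *ᵥ a) + (b ⬝ᵥ n - b' ⬝ᵥ n) = 2 * (t + n ⬝ᵥ γ) := by
      have h2 : 2 * (n ⬝ᵥ γ) = n ⬝ᵥ b + n ⬝ᵥ (S *ᵥ a) + n ⬝ᵥ S.diag - n ⬝ᵥ b' := by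
        simp only [dotProduct, Finset.mul_sum, ← Finset.sum_add_distrib, ← Finset.sum_sub_distrib]
        refine Finset.sum_congr rfl fun i _ => ?_
        rw [Matrix.diag]
        linear_combination -n i * hγ i
      rw [dotProduct_comm b, dotProduct_comm b']
      linear_combination ht - h2
    have h3 : ∀ β : Fin g → ℤ, (fun i => (β i : ℂ)) ⬝ᵥ (fun i => (thetaVec m n i : ℂ)) =
        ((β ⬝ᵥ n : ℤ) : ℂ) + ((β ⬝ᵥ a : ℤ) : ℂ) / 2 := by
      intro β
      rw [thetaVec_cast, ← ha]
      simp only [dotProduct, Int.cast_sum, Finset.sum_div, ← Finset.sum_add_distrib]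
      refine Finset.sum_congr rfl fun i _ => ?_
      push_cast; ring
    have h4 := h3 b
    have h5 := h3 b'
    have h6 := form_add_half hS n a
    have h7 := congrArg (Int.cast : ℤ → ℂ) h1
    push_cast at h7
    rw [thetaExponent_add, thetaExponent, thetaExponent, hv]
    rw [hb] at h4
    rw [hb'] at h5
    rw [h4, h5, thetaVec_cast, ← ha, h6, ← hb, ← hb', hκ]
    push_cast
    linear_combination h7
  rw [thetaTerm, thetaTerm, hexp, exp_pi_mul_add_even, mul_add, Complex.exp_add]

/-- The reduction modulo two of the linear form `m ↦ pᵗ a`. -/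
def charForm (p : Fin g → ℤ) : Characteristic g →ₗ[ZMod 2] ZMod 2 where
  toFun m := (fun i => (p i : ZMod 2)) ⬝ᵥ m.1
  map_add' m n := by simp
  map_smul' c m := by simp

theorem exp_half_pi_mul_sq (P : ℤ) :
    Complex.exp (Real.pi * Complex.I * ((P ^ 2 : ℤ) / 2)) =
      if (P : ZMod 2) = 1 then Complex.I else 1 := by
  rcases Int.even_or_odd' P with ⟨k, rfl | rfl⟩
  · rw [if_neg]
    · have := exp_pi_mul_add_even 0 (k ^ 2)
      rw [mul_zero, Complex.exp_zero, zero_add] at this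
      rw [← this]
      congr 2
      push_cast; ring
    · push_cast
      rw [show (2 : ZMod 2) = 0 from rfl, zero_mul]
      decide
  · rw [if_pos]
    · have := exp_pi_mul_add_even (1 / 2) (k ^ 2 + k)
      rw [show (Real.pi * Complex.I * (1 / 2) : ℂ) = Real.pi / 2 * Complex.I by ring,
        Complex.exp_pi_div_two_mul_I] at this
      refine Eq.trans ?_ this
      congr 1
      push_cast; ring
    · push_cast
      rw [show (2 : ZMod 2) = 0 from rfl, zero_mul, zero_add]

/-- Here `S[n + a / 2]` is an even integer plus `(pᵗ a) ^ 2 / 2`, and a square is `0` or `1` modulo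
four. -/
theorem thetaConstant_translation_two_mul (p : Fin g → ℤ)
    (hS : ((2 : ℤ) • vecMulVec p p)ᵀ = (2 : ℤ) • vecMulVec p p) (m : Characteristic g)
    (Z : siegelHalfSpace g) :
    thetaConstant m (moebius (translation ((2 : ℤ) • vecMulVec p p) hS) Z) =
      (if charForm p m = 1 then Complex.I else 1) * thetaConstant m Z := by
  obtain ⟨a, ha⟩ : ∃ a : Fin g → ℤ, a = fun i => lift (m.1 i) := ⟨_, rfl⟩
  have hP : ((p ⬝ᵥ a : ℤ) : ZMod 2) = charForm p m := by
    rw [ha]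
    simp [dotProduct, charForm, lift_cast]
  rw [← hP, ← exp_half_pi_mul_sq, thetaConstant_eq_tsum, thetaConstant_eq_tsum,
    moebius_translation, ← tsum_mul_left]
  refine tsum_congr fun n => ?_
  have hform : ∀ x y : Fin g → ℤ, x ⬝ᵥ (((2 : ℤ) • vecMulVec p p) *ᵥ y)
      = 2 * ((p ⬝ᵥ x) * (p ⬝ᵥ y)) := by
    intro x y
    rw [Matrix.smul_mulVec, Matrix.vecMulVec_mulVec, dotProduct_smul, smul_eq_mul]
    congr 1
    simp only [dotProduct, Finset.sum_mul, Pi.smul_apply, MulOpposite.smul_eq_mul_unop,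
      MulOpposite.unop_op]
    exact Finset.sum_congr rfl fun i _ => by ring
  have hexp : thetaExponent m n (Z.1 + ((2 : ℤ) • vecMulVec p p).map (Int.cast : ℤ → ℂ)) =
      (((p ⬝ᵥ a) ^ 2 : ℤ) : ℂ) / 2 + thetaExponent m n Z.1
        + 2 * (((p ⬝ᵥ n) ^ 2 + (p ⬝ᵥ n) * (p ⬝ᵥ a) : ℤ) : ℂ) := by
    have h6 := form_add_half hS n a
    rw [hform, hform, hform] at h6
    rw [thetaExponent_add, thetaVec_cast, ← ha, h6]
    push_cast; ring
  rw [thetaTerm, thetaTerm, hexp, exp_pi_mul_add_even, mul_add, Complex.exp_add]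

end TranslationFormula

/-! ### Theta constants under inversion in one coordinate. -/

section InversionFormula

variable {g : ℕ}

/-- A one-dimensional theta series with characteristic, in terms of `jacobiTheta₂`. -/
theorem tsum_exp_eq_jacobiTheta₂ (τ L : ℂ) (a b : ℤ) :
    ∑' p : ℤ, Complex.exp (Real.pi * Complex.I *
        (τ * (p + a / 2) ^ 2 + 2 * (p + a / 2) * L + b * (p + a / 2))) =
      Complex.exp (Real.pi * Complex.I * (τ * a ^ 2 / 4 + a * L + a * b / 2)) *
        jacobiTheta₂ (τ * a / 2 + L + b / 2) τ := by
  rw [jacobiTheta₂, ← tsum_mul_left]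
  refine tsum_congr fun p => ?_
  rw [jacobiTheta₂_term, ← Complex.exp_add]
  congr 1
  ring

theorem jacobiTheta₂_add_int (z τ : ℂ) (a : ℤ) : jacobiTheta₂ (z + a) τ = jacobiTheta₂ z τ := by
  induction a with
  | zero => simp
  | succ k ih => rw [← ih]; push_cast; rw [← add_assoc, jacobiTheta₂_add_left]
  | pred k ih =>
    rw [← ih, ← jacobiTheta₂_add_left]
    congr 1
    push_cast
    ring

/-- The functional equation of `jacobiTheta₂`, which exchanges `a` and `b`. The variable `L` will
hold the contribution of the other coordinates. -/
theorem tsum_exp_inversion {τ : ℂ} (hτ : τ ≠ 0) (L : ℂ) (a b : ℤ) :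
    ∑' p : ℤ, Complex.exp (Real.pi * Complex.I *
        (τ * (p + a / 2) ^ 2 + 2 * (p + a / 2) * L + b * (p + a / 2))) =
      1 / (-Complex.I * τ) ^ (1 / 2 : ℂ) *
        Complex.exp (Real.pi * Complex.I * (-(a * b / 2))) *
        (Complex.exp (Real.pi * Complex.I * (-(L ^ 2 / τ))) *
          ∑' p : ℤ, Complex.exp (Real.pi * Complex.I *
            (-1 / τ * (p + b / 2) ^ 2 + 2 * (p + b / 2) * (-L / τ) + a * (p + b / 2)))) := by
  rw [tsum_exp_eq_jacobiTheta₂, tsum_exp_eq_jacobiTheta₂, jacobiTheta₂_functional_equation,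
    ← jacobiTheta₂_neg_left, ← jacobiTheta₂_add_int _ _ a]
  -- The functional equation followed by `z ↦ -z` gives the desired argument only up to the period
  -- `a`.
  have e1 : -((τ * a / 2 + L + b / 2) / τ) + a = -1 / τ * b / 2 + -L / τ + a / 2 := by
    field_simp; ring
  have e2 : Complex.exp (Real.pi * Complex.I * (τ * a ^ 2 / 4 + a * L + a * b / 2)) *
      Complex.exp (-Real.pi * Complex.I * (τ * a / 2 + L + b / 2) ^ 2 / τ) =
      Complex.exp (Real.pi * Complex.I * (-(a * b / 2))) *
        (Complex.exp (Real.pi * Complex.I * (-(L ^ 2 / τ))) *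
          Complex.exp (Real.pi * Complex.I * (-1 / τ * b ^ 2 / 4 + b * (-L / τ) + b * a / 2))) := by
    simp only [← Complex.exp_add]
    congr 1
    field_simp; ring
  rw [e1]
  linear_combination (1 / (-Complex.I * τ) ^ (1 / 2 : ℂ) *
    jacobiTheta₂ (-1 / τ * b / 2 + -L / τ + a / 2) (-1 / τ)) * e2

theorem form_split (i : Fin g) {Z : Matrix (Fin g) (Fin g) ℂ} (hZ : ∀ j k, Z j k = Z k j)
    (v : Fin g → ℂ) :
    v ⬝ᵥ (Z *ᵥ v) = Z i i * v i ^ 2 + 2 * v i * ∑ j ∈ Finset.univ.erase i, Z i j * v j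
      + ∑ j ∈ Finset.univ.erase i, ∑ k ∈ Finset.univ.erase i, v j * (Z j k * v k) := by
  simp only [dotProduct, mulVec]
  rw [← Finset.add_sum_erase _ _ (Finset.mem_univ i)]
  have e : ∑ j ∈ Finset.univ.erase i, v j * ∑ k, Z j k * v k =
      v i * ∑ j ∈ Finset.univ.erase i, Z i j * v j
      + ∑ j ∈ Finset.univ.erase i, ∑ k ∈ Finset.univ.erase i, v j * (Z j k * v k) := by
    rw [Finset.mul_sum, ← Finset.sum_add_distrib]
    refine Finset.sum_congr rfl fun j _ => ?_
    rw [← Finset.add_sum_erase _ _ (Finset.mem_univ i), mul_add, Finset.mul_sum, hZ j i]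
    ring
  rw [e, ← Finset.add_sum_erase _ _ (Finset.mem_univ i)]
  ring

/-- In comparison with `form_split`, the linear coefficient `L` becomes `-L / Z i i` and the
remainder gains `-L ^ 2 / Z i i`. These are the changes in the one-dimensional functional equation.
-/
theorem inverted_form_split (i : Fin g) {Z : Matrix (Fin g) (Fin g) ℂ}
    (hZ : ∀ j k, Z j k = Z k j) (v : Fin g → ℂ) :
    v ⬝ᵥ (inverted i Z *ᵥ v) = -1 / Z i i * v i ^ 2
      + 2 * v i * (-(∑ j ∈ Finset.univ.erase i, Z i j * v j) / Z i i)
      + (∑ j ∈ Finset.univ.erase i, ∑ k ∈ Finset.univ.erase i, v j * (Z j k * v k)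
        - (∑ j ∈ Finset.univ.erase i, Z i j * v j) ^ 2 / Z i i) := by
  rw [form_split i]
  · congr 2
    · simp [inverted]
    · congr 1
      rw [← Finset.sum_neg_distrib, Finset.sum_div]
      refine Finset.sum_congr rfl fun j hj => ?_
      simp only [inverted, Matrix.of_apply, if_pos, if_neg (Finset.ne_of_mem_erase hj)]
      ring
    · rw [sq, Finset.sum_mul_sum, Finset.sum_div, ← Finset.sum_sub_distrib]
      refine Finset.sum_congr rfl fun j hj => ?_
      rw [Finset.sum_div, ← Finset.sum_sub_distrib]
      refine Finset.sum_congr rfl fun k hk => ?_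
      simp only [inverted, Matrix.of_apply, if_neg (Finset.ne_of_mem_erase hk),
        if_neg (Finset.ne_of_mem_erase hj), hZ j i]
      ring
  · intro j k
    simp only [inverted, Matrix.of_apply, hZ j k, hZ j i, hZ i k]
    split_ifs <;> first | rfl | ring

/-- Splitting off the `i`-th coordinate of a lattice vector. -/
def splitCoord (i : Fin g) : (({j : Fin g // j ≠ i} → ℤ) × ℤ) ≃ (Fin g → ℤ) :=
  (Equiv.prodComm _ _).trans (Equiv.funSplitAt i ℤ).symm

theorem splitCoord_same (i : Fin g) (r : {j : Fin g // j ≠ i} → ℤ) (p : ℤ) :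
    splitCoord i (r, p) i = p := by
  simp [splitCoord, Equiv.funSplitAt, Equiv.piSplitAt]

theorem splitCoord_ne (i : Fin g) (r : {j : Fin g // j ≠ i} → ℤ) (p : ℤ) {j : Fin g}
    (hj : j ≠ i) : splitCoord i (r, p) j = r ⟨j, hj⟩ := by
  simp [splitCoord, Equiv.funSplitAt, Equiv.piSplitAt, hj]

theorem thetaConstant_eq_tsum_tsum (i : Fin g) (m : Characteristic g) (Z : siegelHalfSpace g) :
    thetaConstant m Z = ∑' r, ∑' p, thetaTerm m (splitCoord i (r, p)) Z.1 := by
  rw [thetaConstant_eq_tsum, ← (splitCoord i).tsum_eq]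
  exact ((splitCoord i).summable_iff.2 (summable_thetaTerm m Z)).tsum_prod

/-- Poisson summation in the `i`-th coordinate alone: with the others fixed, the inner sum is
one-dimensional with parameter `Z i i`, and the factor from the remaining coordinates is common to
both sides. -/
theorem thetaConstant_inversion (i : Fin g) (m : Characteristic g) (Z : siegelHalfSpace g) :
    thetaConstant m Z = 1 / (-Complex.I * Z.1 i i) ^ (1 / 2 : ℂ) *
      Complex.exp (Real.pi * Complex.I * (-(lift (m.1 i) * lift (m.2 i) / 2))) *
      thetaConstant (swapAt i m) (moebius (inversion i) Z) := by
  have hZ : ∀ j k, Z.1 j k = Z.1 k j := symm_apply Z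
  have hsw1 : (swapAt i m).1 i = m.2 i := by simp [swapAt]
  have hsw2 : (swapAt i m).2 i = m.1 i := by simp [swapAt]
  have hsw1' : ∀ j, j ≠ i → (swapAt i m).1 j = m.1 j := fun j hj => by simp [swapAt, hj]
  have hsw2' : ∀ j, j ≠ i → (swapAt i m).2 j = m.2 j := fun j hj => by simp [swapAt, hj]
  rw [thetaConstant_eq_tsum_tsum i m, thetaConstant_eq_tsum_tsum i (swapAt i m),
    moebius_inversion, ← tsum_mul_left]
  refine tsum_congr fun r => ?_
  obtain ⟨L, hL⟩ : ∃ L, L = ∑ j ∈ Finset.univ.erase i,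
    Z.1 i j * (thetaVec m (splitCoord i (r, 0)) j : ℂ) := ⟨_, rfl⟩
  obtain ⟨Q, hQ⟩ : ∃ Q, Q = ∑ j ∈ Finset.univ.erase i, ∑ k ∈ Finset.univ.erase i,
    (thetaVec m (splitCoord i (r, 0)) j : ℂ) *
      (Z.1 j k * (thetaVec m (splitCoord i (r, 0)) k : ℂ)) := ⟨_, rfl⟩
  obtain ⟨B, hB⟩ : ∃ B, B = ∑ j ∈ Finset.univ.erase i,
    (lift (m.2 j) : ℂ) * (thetaVec m (splitCoord i (r, 0)) j : ℂ) := ⟨_, rfl⟩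
  have hv1 : ∀ p, ∀ j ∈ Finset.univ.erase i,
      thetaVec m (splitCoord i (r, p)) j = thetaVec m (splitCoord i (r, 0)) j := by
    intro p j hj
    have hj := Finset.ne_of_mem_erase hj
    simp only [thetaVec, splitCoord_ne i r _ hj]
  have hv2 : ∀ p, ∀ j ∈ Finset.univ.erase i,
      thetaVec (swapAt i m) (splitCoord i (r, p)) j = thetaVec m (splitCoord i (r, 0)) j := by
    intro p j hj
    have hj := Finset.ne_of_mem_erase hj
    simp only [thetaVec, splitCoord_ne i r _ hj, hsw1' j hj]
  have h1 : ∀ p : ℤ, thetaTerm m (splitCoord i (r, p)) Z.1 =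
      Complex.exp (Real.pi * Complex.I * (Q + B)) * Complex.exp (Real.pi * Complex.I *
        (Z.1 i i * (p + (lift (m.1 i) : ℂ) / 2) ^ 2 + 2 * (p + (lift (m.1 i) : ℂ) / 2) * L
          + lift (m.2 i) * (p + (lift (m.1 i) : ℂ) / 2))) := by
    intro p
    have e1 : ((thetaVec m (splitCoord i (r, p)) i : ℝ) : ℂ) = p + (lift (m.1 i) : ℂ) / 2 := by
      simp [thetaVec, splitCoord_same]
    have eL : ∑ j ∈ Finset.univ.erase i,
        Z.1 i j * (thetaVec m (splitCoord i (r, p)) j : ℂ) = L := by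
      rw [hL]
      exact Finset.sum_congr rfl fun j hj => by rw [hv1 p j hj]
    have eQ : ∑ j ∈ Finset.univ.erase i, ∑ k ∈ Finset.univ.erase i,
        (thetaVec m (splitCoord i (r, p)) j : ℂ) *
          (Z.1 j k * (thetaVec m (splitCoord i (r, p)) k : ℂ)) = Q := by
      rw [hQ]
      exact Finset.sum_congr rfl fun j hj => Finset.sum_congr rfl fun k hk => by
        rw [hv1 p j hj, hv1 p k hk]
    have eB : ∑ j ∈ Finset.univ.erase i,
        (lift (m.2 j) : ℂ) * (thetaVec m (splitCoord i (r, p)) j : ℂ) = B := by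
      rw [hB]
      exact Finset.sum_congr rfl fun j hj => by rw [hv1 p j hj]
    rw [thetaTerm, ← Complex.exp_add, thetaExponent, form_split i hZ, ← mul_add]
    congr 2
    simp only [dotProduct]
    rw [← Finset.add_sum_erase _ _ (Finset.mem_univ i), e1,
      eL, eQ, eB]
    ring
  have h2 : ∀ p : ℤ, thetaTerm (swapAt i m) (splitCoord i (r, p)) (inverted i Z.1) =
      Complex.exp (Real.pi * Complex.I * (Q + B)) *
        (Complex.exp (Real.pi * Complex.I * (-(L ^ 2 / Z.1 i i))) *
        Complex.exp (Real.pi * Complex.I *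
        (-1 / Z.1 i i * (p + (lift (m.2 i) : ℂ) / 2) ^ 2
          + 2 * (p + (lift (m.2 i) : ℂ) / 2) * (-L / Z.1 i i)
          + lift (m.1 i) * (p + (lift (m.2 i) : ℂ) / 2)))) := by
    intro p
    have e1 : ((thetaVec (swapAt i m) (splitCoord i (r, p)) i : ℝ) : ℂ) =
        p + (lift (m.2 i) : ℂ) / 2 := by
      simp [thetaVec, splitCoord_same, hsw1]
    have eL : ∑ j ∈ Finset.univ.erase i,
        Z.1 i j * (thetaVec (swapAt i m) (splitCoord i (r, p)) j : ℂ) = L := by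
      rw [hL]
      exact Finset.sum_congr rfl fun j hj => by rw [hv2 p j hj]
    have eQ : ∑ j ∈ Finset.univ.erase i, ∑ k ∈ Finset.univ.erase i,
        (thetaVec (swapAt i m) (splitCoord i (r, p)) j : ℂ) *
          (Z.1 j k * (thetaVec (swapAt i m) (splitCoord i (r, p)) k : ℂ)) = Q := by
      rw [hQ]
      exact Finset.sum_congr rfl fun j hj => Finset.sum_congr rfl fun k hk => by
        rw [hv2 p j hj, hv2 p k hk]
    have eB : ∑ j ∈ Finset.univ.erase i,
        (lift ((swapAt i m).2 j) : ℂ) *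
          (thetaVec (swapAt i m) (splitCoord i (r, p)) j : ℂ) = B := by
      rw [hB]
      exact Finset.sum_congr rfl fun j hj => by rw [hv2 p j hj, hsw2' j (Finset.ne_of_mem_erase hj)]
    rw [thetaTerm, ← Complex.exp_add, ← Complex.exp_add, thetaExponent, inverted_form_split i hZ,
      ← mul_add, ← mul_add]
    congr 2
    simp only [dotProduct]
    rw [← Finset.add_sum_erase _ _ (Finset.mem_univ i), e1,
      eL, eQ, eB, hsw2]
    ring
  simp only [h1, h2, tsum_mul_left]
  rw [tsum_exp_inversion (diag_ne_zero Z i)]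
  ring

end InversionFormula
-- Permutation of the forms and triviality of the multiplier.
section Automorphy

variable {g : ℕ}

/-- The weight `k_g 2 ^ (g - 1)`. -/
def gopelWeight (g : ℕ) : ℕ := gopelExponent g * 2 ^ (g - 1)

/-- The power `θ_G ^ k_g`. -/
noncomputable def gopelForm (G : GopelGroup g) (Z : siegelHalfSpace g) : ℂ :=
  thetaGopel G Z ^ gopelExponent g

/-- `N` permutes the forms `θ_G ^ k_g` up to constant factors, according to `σ`. -/
def PermutesGopelForms (N : ModularGroup g) (σ : Equiv.Perm (GopelGroup g)) : Prop :=
  ∀ G, ∃ c : ℂ, c ≠ 0 ∧ ∀ Z, gopelForm G (moebius N Z) =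
    c * autFactor N Z ^ gopelWeight g * gopelForm (σ G) Z

theorem PermutesGopelForms.mul {M N : ModularGroup g} {σ τ : Equiv.Perm (GopelGroup g)}
    (hM : PermutesGopelForms M σ) (hN : PermutesGopelForms N τ) :
    PermutesGopelForms (M * N) (τ * σ) := by
  intro G
  obtain ⟨c, hc, h⟩ := hM G
  obtain ⟨d, hd, h'⟩ := hN (σ G)
  refine ⟨c * d, mul_ne_zero hc hd, fun Z => ?_⟩
  rw [moebius_mul, h, h', autFactor_mul, mul_pow, Equiv.Perm.mul_apply]
  ring

/-- The factor `s` occurs `2 ^ g k_g` times, twice the weight, so only its square matters and the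
choice of a square root disappears. -/
theorem permutesGopelForms_of_theta (hg : 1 ≤ g) {N : ModularGroup g}
    {L : Characteristic g ≃ₗ[ZMod 2] Characteristic g} {φ : Characteristic g → Characteristic g}
    (hφ : IsParityAffine L φ) {s : siegelHalfSpace g → ℂ} {d : ℂ} (hd : d ≠ 0)
    (hs : ∀ Z, s Z ^ 2 = d * autFactor N Z)
    (hθ : ∀ m, ∃ c : ℂ, c ≠ 0 ∧ ∀ Z,
      thetaConstant m (moebius N Z) = c * s Z * thetaConstant (φ m) Z) :
    PermutesGopelForms N (gopelPerm L hφ.pairing) := by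
  classical
  intro G
  choose c hc hθ using hθ
  refine ⟨(∏ m : Characteristic g with m ∈ evenCoset G, c m) ^ gopelExponent g
    * d ^ gopelWeight g, mul_ne_zero (pow_ne_zero _ (Finset.prod_ne_zero_iff.2 fun m _ => hc m))
      (pow_ne_zero _ hd), fun Z => ?_⟩
  have h1 : ∏ m : Characteristic g with m ∈ evenCoset (gopelPerm L hφ.pairing G),
      thetaConstant m Z = ∏ m : Characteristic g with m ∈ evenCoset G,
        thetaConstant (φ m) Z := by
    rw [← Finset.prod_image (f := fun m => thetaConstant m Z) fun m _ n _ h => hφ.injective h]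
    congr 1
    ext m
    simp [evenCoset_gopelPerm hφ]
  have h2 : s Z ^ (2 ^ g * gopelExponent g) = (d * autFactor N Z) ^ gopelWeight g := by
    rw [← hs, ← pow_mul, gopelWeight]
    congr 1
    obtain ⟨n, rfl⟩ : ∃ n, g = n + 1 := ⟨g - 1, by omega⟩
    rw [Nat.add_sub_cancel, pow_succ]
    ring
  simp only [gopelForm, thetaGopel, h1, hθ]
  rw [Finset.prod_mul_distrib, Finset.prod_mul_distrib, Finset.prod_const, card_evenCoset,
    mul_pow, mul_pow, ← pow_mul, h2, mul_pow]
  ring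

theorem translation_char_parity (S : Matrix (Fin g) (Fin g) ℤ) (hS : Sᵀ = S) :
    IsParityAffine (shearEquiv (S.map (Int.cast : ℤ → ZMod 2))) (translateChar S) :=
  isParityAffine_shear (by rw [← Matrix.transpose_map, hS])

theorem permutesGopelForms_translation (hg : 1 ≤ g) (S : Matrix (Fin g) (Fin g) ℤ)
    (hS : Sᵀ = S) : PermutesGopelForms (translation S hS)
      (gopelPerm _ (translation_char_parity S hS).pairing) := by
  refine permutesGopelForms_of_theta hg (translation_char_parity S hS) (s := fun _ => 1)
    one_ne_zero (fun Z => by rw [autFactor_translation]; norm_num) fun m => ?_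
  obtain ⟨c, hc, h⟩ := thetaConstant_translation S hS m
  exact ⟨c, hc, fun Z => by rw [h, mul_one]⟩

theorem swapAt_swapAt (i : Fin g) (m : Characteristic g) : swapAt i (swapAt i m) = m :=
  (swapAt i).left_inv m

theorem permutesGopelForms_inversion (hg : 1 ≤ g) (i : Fin g) :
    PermutesGopelForms (inversion i) (gopelPerm _ (isParityAffine_swapAt i).pairing) := by
  refine permutesGopelForms_of_theta hg (isParityAffine_swapAt i)
    -- The factor of automorphy is `-Z i i`, hence `s ^ 2` is `i` times it.
    (s := fun Z => (-Complex.I * Z.1 i i) ^ (1 / 2 : ℂ)) Complex.I_ne_zero (fun Z => ?_)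
    fun m => ?_
  · rw [autFactor_inversion, ← Complex.cpow_nat_mul]
    norm_num
  · refine ⟨(Complex.exp (Real.pi * Complex.I *
      (-(lift ((swapAt i m).1 i) * lift ((swapAt i m).2 i) / 2))))⁻¹,
      inv_ne_zero (Complex.exp_ne_zero _), fun Z => ?_⟩
    have h := thetaConstant_inversion i (swapAt i m) Z
    have h0 : (-Complex.I * Z.1 i i) ^ (1 / 2 : ℂ) ≠ 0 := by
      rw [Ne, Complex.cpow_eq_zero_iff, not_and_or]
      exact Or.inl (mul_ne_zero (neg_ne_zero.2 Complex.I_ne_zero) (diag_ne_zero Z i))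
    have h1 := Complex.exp_ne_zero (Real.pi * Complex.I *
      (-(lift ((swapAt i m).1 i) * lift ((swapAt i m).2 i) / 2)))
    rw [swapAt_swapAt] at h
    rw [h]
    generalize (-Complex.I * Z.1 i i) ^ (1 / 2 : ℂ) = s at h0
    field_simp

/-- The modular matrices under which all forms `θ_G ^ k_g` transform with trivial multiplier. -/
def gopelStabilizer (g : ℕ) : Subgroup (ModularGroup g) where
  carrier := {M | ∀ G Z, gopelForm G (moebius M Z) =
    autFactor M Z ^ gopelWeight g * gopelForm G Z}
  mul_mem' {M N} hM hN G Z := by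
    rw [moebius_mul, hM, hN, autFactor_mul, mul_pow, mul_assoc]
  one_mem' G Z := by rw [moebius_one, autFactor_one, one_pow, one_mul]
  inv_mem' {M} hM G Z := by
    have h1 := hM G (moebius M⁻¹ Z)
    have h2 := autFactor_mul M M⁻¹ Z
    rw [← moebius_mul, mul_inv_cancel, moebius_one] at h1
    rw [mul_inv_cancel, autFactor_one] at h2
    rw [h1, ← mul_assoc, ← mul_pow, mul_comm (autFactor M⁻¹ Z), ← h2, one_pow, one_mul]

/-- The constant and the permutation belonging to `N` occur both before and after applying `M`, so
they cancel; the cocycle relation matches the remaining factors. -/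
theorem PermutesGopelForms.conj_mem {M N : ModularGroup g} {σ : Equiv.Perm (GopelGroup g)}
    (hN : PermutesGopelForms N σ) (hM : M ∈ gopelStabilizer g) :
    N * M * N⁻¹ ∈ gopelStabilizer g := by
  intro G Z
  obtain ⟨c, hc, h⟩ := hN G
  obtain ⟨W, rfl⟩ : ∃ W, Z = moebius N W :=
    ⟨moebius N⁻¹ Z, by rw [← moebius_mul, mul_inv_cancel, moebius_one]⟩
  have h1 := autFactor_mul (N * M * N⁻¹) N W
  rw [inv_mul_cancel_right, autFactor_mul] at h1
  rw [← moebius_mul, inv_mul_cancel_right, moebius_mul, h, h, hM]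
  calc _ = c * (autFactor N (moebius M W) * autFactor M W) ^ gopelWeight g *
        gopelForm (σ G) W := by ring
    _ = _ := by rw [h1]; ring

theorem PermutesGopelForms.mul_mem {M N : ModularGroup g} {σ : Equiv.Perm (GopelGroup g)}
    (hN : PermutesGopelForms N σ) (hM : M ∈ gopelStabilizer g) :
    PermutesGopelForms (N * M) σ := by
  have h : PermutesGopelForms M 1 := fun G =>
    ⟨1, one_ne_zero, fun Z => (hM G Z).trans (by rw [one_mul, Equiv.Perm.one_apply])⟩
  simpa using hN.mul h

theorem symplecticTransvection_elim (p : Fin g → ℤ)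
    (hS : ((2 : ℤ) • vecMulVec p p)ᵀ = (2 : ℤ) • vecMulVec p p) :
    symplecticTransvection 2 (Sum.elim p 0) = translation ((2 : ℤ) • vecMulVec p p) hS := by
  refine modularGroup_ext fun x => ?_
  rw [symplecticTransvection_mulVec, symplecticForm_eq_sum, translation,
    ← Sum.elim_comp_inl_inr x, fromBlocks_mulVec, Matrix.smul_mulVec, Matrix.vecMulVec_mulVec]
  ext (i | i)
  · simp [dotProduct, mul_assoc, mul_comm (p i)]
  · simp

/-- The multiplier is `i` to the power `k_g` times the number of coset members with `pᵗ a` odd, a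
multiple of four. -/
theorem symplecticTransvection_elim_mem (hg : 1 ≤ g) (p : Fin g → ℤ) :
    symplecticTransvection 2 (Sum.elim p 0) ∈ gopelStabilizer g := by
  classical
  have hS : ((2 : ℤ) • vecMulVec p p)ᵀ = (2 : ℤ) • vecMulVec p p := by
    rw [Matrix.transpose_smul, Matrix.transpose_vecMulVec]
  rw [symplecticTransvection_elim p hS]
  intro G Z
  rw [autFactor_translation, one_pow, one_mul, gopelForm, thetaGopel]
  simp only [thetaConstant_translation_two_mul]
  obtain ⟨t, ht⟩ := four_dvd_card_filter hg G (charForm p)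
  rw [Finset.prod_mul_distrib, mul_pow, Finset.prod_ite, Finset.prod_const, Finset.prod_const_one,
    mul_one, Finset.filter_filter, ← pow_mul, mul_comm _ (gopelExponent g), ht, pow_mul,
    Complex.I_pow_four, one_pow, one_mul]
  rfl

theorem inversion_mulVec (i : Fin g) (x : Fin g ⊕ Fin g → ℤ) :
    (inversion i).1 *ᵥ x = x - (x (Sum.inl i) - x (Sum.inr i)) • stdVec (Sum.inl i)
      - (x (Sum.inl i) + x (Sum.inr i)) • stdVec (Sum.inr i) := by
  have e : ∀ y : Fin g → ℤ, Matrix.single i i (1 : ℤ) *ᵥ y = Pi.single i (y i) := by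
    intro y; ext j; simp [Matrix.single_mulVec, Pi.single_apply, Function.update_apply]
  rw [inversion, ← Sum.elim_comp_inl_inr x, fromBlocks_mulVec, Matrix.sub_mulVec,
    Matrix.sub_mulVec, Matrix.neg_mulVec, Matrix.one_mulVec, Matrix.one_mulVec, e, e]
  ext (j | j) <;> by_cases h : j = i
  · subst h; simp
  · simp [h]
  · subst h; simp
  · simp [h]

/-- Inversion at `i` maps the basis vectors `e_i`, `f_i` to `-f_i`, `e_i`, so conjugation turns
translations into all required squares except those along `e_i + f_i`. These come from `f_i` by the
translation with a single diagonal entry. -/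
theorem hasSquares_gopelStabilizer (hg : 1 ≤ g) :
    HasSquares (gopelStabilizer g ⊓ principalCongruenceSubgroup g 2) := by
  have hneg : ∀ u, symplecticTransvection 2 u ∈ gopelStabilizer g →
      symplecticTransvection 2 (-u) ∈ gopelStabilizer g := fun u hu => by
    rwa [symplecticTransvection_neg]
  have hconj : ∀ {N : ModularGroup g} {σ}, PermutesGopelForms N σ → ∀ u,
      symplecticTransvection 2 u ∈ gopelStabilizer g →
      symplecticTransvection 2 (N.1 *ᵥ u) ∈ gopelStabilizer g := fun hN u hu => by
    rw [← conj_symplecticTransvection]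
    exact hN.conj_mem hu
  have hinv := fun i => hconj (permutesGopelForms_inversion hg i)
  have hl : ∀ (i : Fin g) (c : ℤ), c • stdVec (Sum.inl i) = Sum.elim (Pi.single i c) 0 := by
    intro i c
    ext (j | j)
    · by_cases h : j = i
      · subst h; simp
      · simp [h]
    · simp
  have hll : ∀ (i j : Fin g) (c d : ℤ), symplecticTransvection 2
      (c • stdVec (Sum.inl i) + d • stdVec (Sum.inl j)) ∈ gopelStabilizer g := by
    intro i j c d
    have e : c • stdVec (Sum.inl i) + d • stdVec (Sum.inl j) =
        Sum.elim (Pi.single i c + Pi.single j d) (0 : Fin g → ℤ) := by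
      rw [hl, hl]; ext (k | k) <;> simp only [Pi.add_apply, Sum.elim_inl, Sum.elim_inr]
      rfl
    rw [e]
    exact symplecticTransvection_elim_mem hg _
  have hr : ∀ i, symplecticTransvection 2 (stdVec (Sum.inr i)) ∈ gopelStabilizer g := by
    intro i
    have h := hneg _ (hinv i _ (hll i i 1 0))
    convert h using 2
    rw [inversion_mulVec]
    simp
  have hlr : ∀ (i j : Fin g) (c : ℤ), i ≠ j → symplecticTransvection 2
      (c • stdVec (Sum.inl i) + stdVec (Sum.inr j)) ∈ gopelStabilizer g := by
    intro i j c hij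
    -- The coefficient `-1` offsets the sign in `e_j ↦ -f_j`.
    have h := hinv j _ (hll i j c (-1))
    convert h using 2
    rw [inversion_mulVec]
    simp [hij]
  have hrr : ∀ i j : Fin g, i ≠ j → symplecticTransvection 2
      (stdVec (Sum.inr i) + stdVec (Sum.inr j)) ∈ gopelStabilizer g := by
    intro i j hij
    have h := hinv i _ (hlr i j (-1) hij)
    convert h using 2
    rw [inversion_mulVec]
    simp [hij]
    abel
  have hlr' : ∀ i : Fin g, symplecticTransvection 2
      (stdVec (Sum.inl i) + stdVec (Sum.inr i)) ∈ gopelStabilizer g := by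
    intro i
    have hS : (Matrix.single i i (1 : ℤ))ᵀ = Matrix.single i i 1 := by simp
    have h := hconj (permutesGopelForms_translation hg _ hS) _ (hr i)
    convert h using 2
    rw [translation, ← Sum.elim_comp_inl_inr (stdVec (Sum.inr i)), fromBlocks_mulVec]
    ext (j | j)
    · have e : stdVec (Sum.inr i) ∘ Sum.inr = Pi.single i 1 := by
        ext k; simp [Pi.single_apply]
      simp [e, Pi.single_apply, Matrix.single_apply, eq_comm]
    · simp [Pi.single_apply]
  have hmem : ∀ u, symplecticTransvection 2 u ∈ gopelStabilizer g →
      symplecticTransvection 2 u ∈ gopelStabilizer g ⊓ principalCongruenceSubgroup g 2 :=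
    fun u hu => ⟨hu, by
      exact_mod_cast symplecticTransvection_mem_principalCongruenceSubgroup 2 u⟩
  refine ⟨inf_le_right, fun a => hmem _ ?_, fun a b hab => hmem _ ?_⟩
  · rcases a with i | i
    · simpa using hll i i 1 0
    · exact hr i
  · rcases a with i | i <;> rcases b with j | j
    · simpa using hll i j 1 1
    · by_cases hij : i = j
      · subst hij; exact hlr' i
      · simpa using hlr i j 1 hij
    · rw [add_comm]
      by_cases hij : i = j
      · subst hij; exact hlr' i
      · simpa using hlr j i 1 (Ne.symm hij)
    · exact hrr i j fun h => hab (by rw [h])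

theorem principalCongruenceSubgroup_le_gopelStabilizer (hg : 1 ≤ g) :
    principalCongruenceSubgroup g 2 ≤ gopelStabilizer g := by
  rw [← (hasSquares_gopelStabilizer hg).eq_principalCongruenceSubgroup]
  exact inf_le_left

theorem norm_gopelForm_le (G : GopelGroup g) : ∃ K : ℝ, ∀ Z : siegelHalfSpace g,
    (Z.1.map Complex.im - (1 : ℝ) • (1 : Matrix (Fin g) (Fin g) ℝ)).PosSemidef →
      ‖gopelForm G Z‖ ≤ K := by
  classical
  choose K hK using norm_thetaConstant_le (g := g)
  refine ⟨(∏ m : Characteristic g with m ∈ evenCoset G, K m) ^ gopelExponent g, fun Z hZ => ?_⟩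
  rw [gopelForm, norm_pow, thetaGopel, norm_prod]
  exact pow_le_pow_left₀ (Finset.prod_nonneg fun _ _ => norm_nonneg _)
    (Finset.prod_le_prod (fun _ _ => norm_nonneg _) fun m _ => hK m Z hZ) _

/-- The special linear group over two elements has order six, so an exhaustive check is feasible. -/
theorem exists_word_one : ∀ A : Matrix (Fin 1 ⊕ Fin 1) (Fin 1 ⊕ Fin 1) (ZMod 2),
    A (Sum.inl 0) (Sum.inl 0) * A (Sum.inr 0) (Sum.inr 0)
      - A (Sum.inr 0) (Sum.inl 0) * A (Sum.inl 0) (Sum.inr 0) = 1 →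
    ∃ W ∈ [1, translation (g := 1) 1 Matrix.transpose_one, inversion 0,
      translation 1 Matrix.transpose_one * inversion 0,
      inversion 0 * translation 1 Matrix.transpose_one,
      translation 1 Matrix.transpose_one * inversion 0 * translation 1 Matrix.transpose_one],
      W.1.map (Int.castRingHom (ZMod 2)) = A := by
  decide

/-- Every matrix is one of the six words times an element of level two, which fixes all the forms.
This brings every cusp back to infinity. -/
theorem exists_permutesGopelForms_one (N : ModularGroup 1) : ∃ σ, PermutesGopelForms N σ := by
  have hS : (1 : Matrix (Fin 1) (Fin 1) ℤ)ᵀ = 1 := Matrix.transpose_one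
  have hT := permutesGopelForms_translation le_rfl _ hS
  have hJ := permutesGopelForms_inversion le_rfl (0 : Fin 1)
  have h1 : PermutesGopelForms (1 : ModularGroup 1) 1 := fun G => ⟨1, one_ne_zero, fun Z => by
    rw [moebius_one, autFactor_one]; simp⟩
  have key : ∀ W : ModularGroup 1, (∃ σ, PermutesGopelForms W σ) →
      W.1.map (Int.castRingHom (ZMod 2)) = N.1.map (Int.castRingHom (ZMod 2)) →
      ∃ σ, PermutesGopelForms N σ := by
    rintro W ⟨σ, hW⟩ h
    have hmem : W⁻¹ * N ∈ principalCongruenceSubgroup 1 2 := by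
      have : reduction 1 2 W = reduction 1 2 N := Subtype.ext h
      rw [principalCongruenceSubgroup, MonoidHom.mem_ker, map_mul, map_inv, this, inv_mul_cancel]
    have := hW.mul_mem (principalCongruenceSubgroup_le_gopelStabilizer le_rfl hmem)
    rw [mul_inv_cancel_left] at this
    exact ⟨σ, this⟩
  have hdet : N.1 (Sum.inl 0) (Sum.inl 0) * N.1 (Sum.inr 0) (Sum.inr 0)
      - N.1 (Sum.inr 0) (Sum.inl 0) * N.1 (Sum.inl 0) (Sum.inr 0) = 1 := by
    have h := N.2
    rw [← fromBlocks_toBlocks N.1, SymplecticGroup.fromBlocks_mem_iff] at h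
    have h := congrFun (congrFun h.2.2 0) 0
    simpa [Matrix.mul_apply, toBlocks₁₁, toBlocks₁₂, toBlocks₂₁, toBlocks₂₂] using h
  obtain ⟨W, hW, h⟩ := exists_word_one (N.1.map (Int.castRingHom (ZMod 2)))
    (by simpa using congrArg (Int.cast : ℤ → ZMod 2) hdet)
  refine key W ?_ h
  simp only [List.mem_cons, List.not_mem_nil, or_false] at hW
  rcases hW with rfl | rfl | rfl | rfl | rfl | rfl
  · exact ⟨_, h1⟩
  · exact ⟨_, hT⟩
  · exact ⟨_, hJ⟩
  · exact ⟨_, hT.mul hJ⟩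
  · exact ⟨_, hJ.mul hT⟩
  · exact ⟨_, (hT.mul hJ).mul hT⟩

end Automorphy

/-! ### Linear independence. -/

section Independence

variable {g : ℕ}

/-- The coefficient of `θ_G ^ k_g` vanishes in every linear relation. -/
def CoefficientVanishes (G : GopelGroup g) : Prop :=
  ∀ c : GopelGroup g → ℂ, (∀ Z, ∑ᶠ G', c G' * gopelForm G' Z = 0) → c G = 0

/-- Evaluating a relation at `N Z` and cancelling the factor of automorphy gives a relation whose
coefficients are permuted by `σ` and rescaled by nonzero constants. -/
theorem CoefficientVanishes.of_permutes {N : ModularGroup g} {σ : Equiv.Perm (GopelGroup g)}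
    (hN : PermutesGopelForms N σ) {G : GopelGroup g} (h : CoefficientVanishes (σ G)) :
    CoefficientVanishes G := by
  intro c hc
  choose d hd hN using hN
  have := Fintype.ofFinite (GopelGroup g)
  simp only [CoefficientVanishes, finsum_eq_sum_of_fintype] at h hc
  have key := h (fun G' => c (σ.symm G') * d (σ.symm G')) fun Z => by
    have h1 := hc (moebius N Z)
    have e : ∀ G', c G' * gopelForm G' (moebius N Z) = autFactor N Z ^ gopelWeight g *
        (c G' * d G' * gopelForm (σ G') Z) := fun G' => by rw [hN]; ring
    simp only [e] at h1
    rw [← Finset.mul_sum, mul_eq_zero] at h1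
    have h2 := h1.resolve_left (pow_ne_zero _ (autFactor_ne_zero N Z))
    rw [← h2, ← Equiv.sum_comp σ]
    simp
  simpa [hd G] using key

/-- A Göpel group all of whose elements have first row zero. -/
def IsFlat (G : GopelGroup g) : Prop := ∀ x ∈ G.1, x.1 = 0

theorem IsFlat.eq {G G' : GopelGroup g} (h : IsFlat G) (h' : IsFlat G') : G = G' := by
  have key : ∀ {G G' : GopelGroup g}, IsFlat G → IsFlat G' → G.1 ≤ G'.1 := fun h h' x hx =>
    mem_of_pairing_eq_zero (Subtype.prop _) fun n hn => by simp [pairing, h x hx, h' n hn]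
  exact Subtype.ext (le_antisymm (key h h') (key h' h))

theorem isFlat_iff_evenCoset {G : GopelGroup g} :
    IsFlat G ↔ ∀ m ∈ evenCoset G, m.1 = 0 := by
  constructor
  · intro h
    have e : evenCoset G = (G.1 : Set (Characteristic g)) := by
      refine evenCoset_eq_of_isEvenTranslate ⟨⟨0, ?_⟩, fun m hm => ?_⟩
      · ext m; simp
      · rw [IsEven, h m hm, zero_dotProduct]
    rw [e]
    exact h
  · intro h x hx
    obtain ⟨m, hm⟩ := evenCoset_nonempty G
    have h1 := h _ (add_mem_evenCoset hm hx)
    rwa [Prod.fst_add, h m hm, zero_add] at h1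

theorem gopelExponent_ne_zero (g : ℕ) : gopelExponent g ≠ 0 := by
  unfold gopelExponent; split_ifs <;> norm_num

open Classical in
theorem tendsto_gopelForm_cuspPoint (G : GopelGroup g) :
    Filter.Tendsto (fun N => gopelForm G (cuspPoint g N)) Filter.atTop
      (nhds (if IsFlat G then 1 else 0)) := by
  have h : Filter.Tendsto (fun N => gopelForm G (cuspPoint g N)) Filter.atTop
      (nhds ((∏ m : Characteristic g with m ∈ evenCoset G, if m.1 = 0 then (1 : ℂ) else 0)
        ^ gopelExponent g)) :=
    (tendsto_finsetProd _ fun m _ => tendsto_thetaConstant_cuspPoint m).pow _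
  convert h using 2
  split_ifs with hG
  · rw [isFlat_iff_evenCoset] at hG
    rw [Finset.prod_eq_one, one_pow]
    intro m hm
    rw [if_pos (hG m (by simpa using hm))]
  · rw [isFlat_iff_evenCoset] at hG
    push Not at hG
    obtain ⟨m, hm, hm0⟩ := hG
    rw [Finset.prod_eq_zero (i := m) (by simpa using hm) (if_neg hm0),
      zero_pow (gopelExponent_ne_zero g)]

/-- In the limit along `cuspPoint` only flat groups contribute, and there is at most one of them. -/
theorem IsFlat.coefficientVanishes {G : GopelGroup g} (hG : IsFlat G) :
    CoefficientVanishes G := by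
  classical
  intro c hc
  have := Fintype.ofFinite (GopelGroup g)
  simp only [finsum_eq_sum_of_fintype] at hc
  have h1 : Filter.Tendsto (fun N => ∑ G', c G' * gopelForm G' (cuspPoint g N)) Filter.atTop
      (nhds (∑ G', c G' * if IsFlat G' then 1 else 0)) :=
    tendsto_finsetSum _ fun G' _ => (tendsto_gopelForm_cuspPoint G').const_mul _
  simp only [hc] at h1
  have h2 := tendsto_nhds_unique h1 tendsto_const_nhds
  rw [Finset.sum_eq_single G] at h2
  · simpa [hG] using h2
  · intro G' _ hne
    rw [if_neg fun h => hne (IsFlat.eq h hG), mul_zero]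
  · simp

/-- Each inversion exchanges the two rows at one index of `I`; when `I` is exhausted the group is
flat. -/
theorem coefficientVanishes_of_coordinate (hg : 1 ≤ g) (I : Finset (Fin g)) :
    ∀ G : GopelGroup g, (∀ x ∈ G.1, (∀ i ∈ I, x.2 i = 0) ∧ ∀ i ∉ I, x.1 i = 0) →
      CoefficientVanishes G := by
  induction I using Finset.induction_on with
  | empty =>
    intro G hG
    exact IsFlat.coefficientVanishes fun x hx => funext fun i => (hG x hx).2 i (by simp)
  | insert i I hi ih =>
    intro G hG
    refine CoefficientVanishes.of_permutes (permutesGopelForms_inversion hg i) (ih _ ?_)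
    rintro _ ⟨x, hx, rfl⟩
    obtain ⟨h1, h2⟩ := hG x hx
    constructor
    · intro j hj
      have hji : j ≠ i := fun h => hi (h ▸ hj)
      simpa [swapAt, hji] using h1 j (Finset.mem_insert_of_mem hj)
    · intro j hj
      by_cases hji : j = i
      · subst hji
        simpa [swapAt] using h1 j (Finset.mem_insert_self _ _)
      · simpa [swapAt, hji] using h2 j (by simp [hji, hj])

/-- Projection to the first row is injective on `G`, hence bijective by dimension, so `G` is the
graph of a linear map. Isotropy says that its matrix is symmetric. -/
theorem exists_symmetric_of_transversal {G : GopelGroup g}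
    (hG : ∀ x ∈ G.1, x.1 = 0 → x = 0) :
    ∃ S : Matrix (Fin g) (Fin g) (ZMod 2), Sᵀ = S ∧ ∀ x ∈ G.1, x.2 = S *ᵥ x.1 := by
  let f : G.1 →ₗ[ZMod 2] (Fin g → ZMod 2) := LinearMap.fst _ _ _ ∘ₗ G.1.subtype
  have hf : Function.Injective f := by
    rw [injective_iff_map_eq_zero]
    intro x hx
    exact Subtype.ext (hG x x.2 hx)
  let e := LinearMap.linearEquivOfInjective f hf (by
    rw [finrank_gopelGroup G.2, Module.finrank_fin_fun])
  let s : (Fin g → ZMod 2) →ₗ[ZMod 2] (Fin g → ZMod 2) :=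
    LinearMap.snd _ _ _ ∘ₗ G.1.subtype ∘ₗ e.symm.toLinearMap
  have hs : ∀ a, (e.symm a).1 = (a, s a) := fun a =>
    Prod.ext (e.apply_symm_apply a) rfl
  refine ⟨LinearMap.toMatrix' s, ?_, fun x hx => ?_⟩
  · ext i j
    have h := G.2.1 _ (e.symm (Pi.single i 1)).2 _ (e.symm (Pi.single j 1)).2
    rw [hs, hs, pairing, single_one_dotProduct, dotProduct_single_one] at h
    rw [transpose_apply, LinearMap.toMatrix'_apply, LinearMap.toMatrix'_apply]
    have h' := zmod_add_self (s (Pi.single j 1) i)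
    exact (add_left_cancel (h'.trans h.symm)).symm
  · rw [LinearMap.toMatrix'_mulVec]
    have h : e ⟨x, hx⟩ = x.1 := rfl
    rw [← h]
    change x.2 = (e.symm (e ⟨x, hx⟩)).1.2
    rw [LinearEquiv.symm_apply_apply]

/-- Translation by an integral lift of `S` moves the graph of `S` to the group with second row zero.
-/
theorem coefficientVanishes_of_transversal (hg : 1 ≤ g) {G : GopelGroup g}
    (hG : ∀ x ∈ G.1, x.1 = 0 → x = 0) : CoefficientVanishes G := by
  obtain ⟨S, hS, h⟩ := exists_symmetric_of_transversal hG
  have hS' : (S.map lift)ᵀ = S.map lift := by rw [← Matrix.transpose_map, hS]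
  refine CoefficientVanishes.of_permutes (permutesGopelForms_translation hg _ hS')
    (coefficientVanishes_of_coordinate hg Finset.univ _ ?_)
  rintro _ ⟨x, hx, rfl⟩
  refine ⟨fun i _ => ?_, fun i hi => absurd (Finset.mem_univ i) hi⟩
  have e : (S.map lift).map (Int.cast : ℤ → ZMod 2) = S := by
    ext i j; simp [lift_cast]
  have : (shearEquiv ((S.map lift).map (Int.cast : ℤ → ZMod 2)) x).2 = x.2 + S *ᵥ x.1 := by
    rw [e]; rfl
  change (shearEquiv ((S.map lift).map (Int.cast : ℤ → ZMod 2)) x).2 i = 0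
  rw [this, h x hx]
  exact zmod_add_self _

/-- Induction on the size of the intersection of `G` with the characteristics of first row zero. A
nonzero `y` in it with `y.2 i ≠ 0` makes the inversion at `i` shrink this intersection, until `G` is
transversal. -/
theorem coefficientVanishes (hg : 1 ≤ g) (G : GopelGroup g) : CoefficientVanishes G := by
  obtain ⟨n, hn⟩ : ∃ n, {x | x ∈ G.1 ∧ x.1 = 0}.ncard = n := ⟨_, rfl⟩
  induction n using Nat.strong_induction_on generalizing G with
  | _ n ih =>
    by_cases h : ∀ x ∈ G.1, x.1 = 0 → x = 0
    · exact coefficientVanishes_of_transversal hg h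
    push Not at h
    obtain ⟨y, hy, hy1, hy0⟩ := h
    obtain ⟨i, hi⟩ : ∃ i, y.2 i ≠ 0 := by
      by_contra hc
      push Not at hc
      exact hy0 (Prod.ext hy1 (funext hc))
    refine CoefficientVanishes.of_permutes (permutesGopelForms_inversion hg i)
      (ih _ ?_ _ rfl)
    rw [← hn, ← Set.ncard_image_of_injective _ (swapAt i).injective]
    refine Set.ncard_lt_ncard ?_ (Set.toFinite _)
    -- Swapping back embeds the new intersection in the old one: the first row of a swapped-back
    -- element is supported at `i`, and its pairing with `y` forces it to vanish there too. The
    -- element `y` is missed because its second row is nonzero at `i`.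
    rw [Set.ssubset_iff_of_subset]
    · refine ⟨y, ⟨hy, hy1⟩, ?_⟩
      rintro ⟨x, ⟨-, hx1⟩, hxy⟩
      apply hi
      rw [← hxy]
      simp [swapAt, hx1]
    · rintro _ ⟨_, ⟨⟨x, hx, rfl⟩, hx1⟩, rfl⟩
      have e : swapAt i ((swapAt i).toLinearMap x) = x := swapAt_swapAt i x
      rw [e]
      refine ⟨hx, ?_⟩
      have hx1' : ∀ j, j ≠ i → x.1 j = 0 := fun j hj => by
        have := congrFun hx1 j
        simpa [swapAt, hj] using this
      have hp := G.2.1 x hx y hy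
      rw [pairing, hy1, dotProduct_zero, add_zero, dotProduct,
        Finset.sum_eq_single i (fun j _ hj => by rw [hx1' j hj, zero_mul]) (by simp)] at hp
      funext j
      by_cases hj : j = i
      · rw [hj]; exact (mul_eq_zero.1 hp).resolve_right hi
      · exact hx1' j hj

end Independence
end SiegelTheta

theorem lemma3p2 (g : ℕ) (hg : 1 ≤ g) :
    (∀ G : SiegelTheta.GopelGroup g,
      SiegelTheta.IsSiegelModularForm (SiegelTheta.principalCongruenceSubgroup g 2)
        ((SiegelTheta.gopelExponent g * 2 ^ (g - 1) : ℕ) : ℤ)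
        (fun Z => SiegelTheta.thetaGopel G Z ^ SiegelTheta.gopelExponent g)) ∧
    LinearIndependent ℂ (fun (G : SiegelTheta.GopelGroup g) (Z : SiegelTheta.siegelHalfSpace g) =>
      SiegelTheta.thetaGopel G Z ^ SiegelTheta.gopelExponent g) := by
  refine ⟨fun G => ⟨SiegelTheta.isHolomorphic_thetaGopel_pow G _, fun M hM Z => ?_, ?_⟩, ?_⟩
  · rw [zpow_natCast]
    exact SiegelTheta.principalCongruenceSubgroup_le_gopelStabilizer hg hM G Z
  · rintro rfl N
    obtain ⟨σ, hN⟩ := SiegelTheta.exists_permutesGopelForms_one N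
    obtain ⟨c, -, h⟩ := hN G
    obtain ⟨K, hK⟩ := SiegelTheta.norm_gopelForm_le (σ G)
    -- At any cusp the transformed form is `c` times another of the forms, which is bounded for `Im
    -- Z ≥ 1`.
    refine ⟨1, ‖c‖ * K, fun Z hZ => ?_⟩
    have e := h Z
    rw [SiegelTheta.gopelForm] at e
    have h0 := pow_ne_zero (SiegelTheta.gopelWeight 1) (SiegelTheta.autFactor_ne_zero N Z)
    have e' : SiegelTheta.autFactor N Z ^
        (-((SiegelTheta.gopelExponent 1 * 2 ^ (1 - 1) : ℕ) : ℤ)) *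
          SiegelTheta.thetaGopel G (SiegelTheta.moebius N Z) ^ SiegelTheta.gopelExponent 1 =
        c * SiegelTheta.gopelForm (σ G) Z := by
      rw [e, _root_.zpow_neg, zpow_natCast]
      change (SiegelTheta.autFactor N Z ^ SiegelTheta.gopelWeight 1)⁻¹ * _ = _
      field_simp
    rw [e', norm_mul]
    exact mul_le_mul_of_nonneg_left (hK Z hZ) (norm_nonneg c)
  · have := Fintype.ofFinite (SiegelTheta.GopelGroup g)
    rw [Fintype.linearIndependent_iff]
    intro c hc G
    refine SiegelTheta.coefficientVanishes hg G c fun Z => ?_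
    rw [finsum_eq_sum_of_fintype]
    have := congrFun hc Z
    simpa [Finset.sum_apply, SiegelTheta.gopelForm] using this
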